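/- For an integer $n$ and real $q\neq 0$ let $[n]_q=(1-q^n)/(1-q)$ if $q\neq 1$, and $[n]_1=n$. Let $N\geq 1$ be an integer and let $q,\gamma$ be real numbers with $q\neq 0$. The coordinate algebra $\mathcal{O}(C^N_{q,\gamma})$ of the quantum $N$-cone is the complex $*$-algebra generated by a selfadjoint element $a$ and by $b,b^*$ subject to the relations (and their adjoints) $$ab=q^N\,ba+\gamma[N]_q\,b,\qquad bb^*=\prod_{l=0}^{N-1}\bigl(q^{-l}a+\gamma[-l]_q\bigr),\qquad b^*b=\prod_{l=1}^{N}\bigl(q^{l}a+\gamma[l]_q\bigr).$$ A complex algebra $A$ with enveloping algebra $A^e=A\otimes_{\mathbb{C}}A^{op}$ is called a twisted Calabi–Yau algebra of dimension $d$ if (i) it is homologically smooth, that is, $A$ has a resolution of finite length by finitely generated projective $A$-bimodules; (ii) $HH^i(A,A^e)=\mathrm{Ext}^i_{A^e}(A,A^e)=0$ for all $i\neq d$; and (iii) $HH^d(A,A^e)$ is isomorphic, as an $A$-bimodule, to $A$ with the right action twisted by an algebra automorphism $\nu$ of $A$, that is, with $u\cdot m\cdot v=u\,m\,\nu(v)$.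 Theorem. If $\gamma\neq 0$, and if $N\leq 2$ in the case $q=-1$ (equivalently, if $\gamma \neq 0$ and $[l]_q\neq 0$ for $1\leq l\leq N-1$), then $\mathcal{O}(C^N_{q,\gamma})$ is a twisted Calabi–Yau algebra of dimension two. -/

import Mathlib

open CategoryTheory
open scoped TensorProduct

noncomputable section

/-! ### Bimodules and twisted Calabi-Yau algebras -/

section CalabiYau

universe u v

variable (k : Type u) [Field k] (A : Type v) [Ring A] [Algebra k A]

/-- The enveloping algebra `A ⊗ Aᵒᵖ`; its left modules are the `A`-bimodules with central
action of `k`. -/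
abbrev EnvelopingAlgebra : Type v := A ⊗[k] Aᵐᵒᵖ

/-- `A` as a bimodule over itself: the left module over the enveloping algebra with
`(u ⊗ op v) • x = u * x * v`. -/
def diagonalBimodule : ModuleCat.{v} (EnvelopingAlgebra k A) :=
  letI : Module (EnvelopingAlgebra k A) A := instModuleTensorProductMop k A
  ModuleCat.of (EnvelopingAlgebra k A) A

/-- The enveloping algebra as a left module over itself, i.e. with its outer bimodule
structure. -/
def envelopingBimodule : ModuleCat.{v} (EnvelopingAlgebra k A) :=
  ModuleCat.of (EnvelopingAlgebra k A) (EnvelopingAlgebra k A)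

/-- Right multiplication `x ↦ x * w`, an endomorphism of the left regular module of the
enveloping algebra. -/
def rightMul (w : EnvelopingAlgebra k A) : envelopingBimodule k A ⟶ envelopingBimodule k A :=
  ModuleCat.ofHom (LinearMap.toSpanSingleton (EnvelopingAlgebra k A) (EnvelopingAlgebra k A) w)

/-- The Hochschild cohomology group `HH^n(A, A ⊗ Aᵒᵖ)` of `A` with values in its enveloping
algebra, i.e. `Ext^n(A, A ⊗ Aᵒᵖ)` in the category of `A`-bimodules. -/
abbrev EnvHochschild (n : ℕ) : Type v :=
  Abelian.Ext.{v} (diagonalBimodule k A) (envelopingBimodule k A) n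

variable {A}

/-- The bimodule structure `ξ ↦ u ξ v` on `HH^n(A, A ⊗ Aᵒᵖ)`, induced by the inner bimodule
structure `u (p ⊗ r) v = p v ⊗ u r` of the coefficients (`u r` is the product in `A`), that
is, by right multiplication with `v ⊗ op u`. -/
def EnvHochschild.act {n : ℕ} (u v : A) (ξ : EnvHochschild k A n) : EnvHochschild k A n :=
  ξ.comp (Abelian.Ext.mk₀ (rightMul k A (v ⊗ₜ[k] MulOpposite.op u))) (add_zero n)

variable (A)

/-- `A` is homologically smooth: as a bimodule it has a resolution of finite length by
finitely generated projective bimodules. -/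
def IsHomologicallySmooth : Prop :=
  ∃ P : ProjectiveResolution (diagonalBimodule k A),
    (∀ i, Module.Finite (EnvelopingAlgebra k A) (P.complex.X i)) ∧
      ∃ n : ℕ, ∀ i, n < i → Limits.IsZero (P.complex.X i)

/-- `A` is a twisted Calabi-Yau algebra of dimension `d`: it is homologically smooth,
`HH^i(A, A ⊗ Aᵒᵖ)` vanishes for `i ≠ d`, and `HH^d(A, A ⊗ Aᵒᵖ)` is isomorphic, as a bimodule,
to `A` with the right action twisted by an algebra automorphism `ν`. -/
structure IsTwistedCalabiYau (d : ℕ) : Prop where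
  smooth : IsHomologicallySmooth k A
  vanishing : ∀ i : ℕ, i ≠ d → Subsingleton (EnvHochschild k A i)
  dualizing : ∃ (ν : A ≃ₐ[k] A) (e : EnvHochschild k A d ≃+ A),
    ∀ (u v : A) (ξ : EnvHochschild k A d),
      e (EnvHochschild.act k u v ξ) = u * e ξ * ν v

end CalabiYau

/-! ### Quantum cones -/

/-- The `q`-integer `[n]_q = (1 - q^n) / (1 - q)`, `n ∈ ℤ`, with its limit value `n` at
`q = 1`. -/
def qInt (q : ℝ) (n : ℤ) : ℝ := if q = 1 then (n : ℝ) else (1 - q ^ n) / (1 - q)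

/-- The polynomial `q^n X + γ [n]_q`. -/
def coneFactor (q γ : ℝ) (n : ℤ) : Polynomial ℂ :=
  Polynomial.C (((q ^ n : ℝ) : ℂ)) * Polynomial.X + Polynomial.C (((γ * qInt q n : ℝ) : ℂ))

/-- The generators `a = a*`, `b` and `b*`. -/
inductive ConeGen : Type
  | a
  | b
  | bstar

namespace QuantumCone

/-- The generator `a` of the free algebra. -/
abbrev genA : FreeAlgebra ℂ ConeGen := FreeAlgebra.ι ℂ ConeGen.a

/-- The generator `b` of the free algebra. -/
abbrev genB : FreeAlgebra ℂ ConeGen := FreeAlgebra.ι ℂ ConeGen.b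

/-- The generator `b*` of the free algebra. -/
abbrev genBstar : FreeAlgebra ℂ ConeGen := FreeAlgebra.ι ℂ ConeGen.bstar

/-- The defining relations. Since these are relations of a `*`-algebra with `a` selfadjoint,
the adjoint `adjoint_comm` of the relation `comm` is included; the two remaining relations
are selfadjoint. -/
inductive Rel (N : ℕ) (q γ : ℝ) : FreeAlgebra ℂ ConeGen → FreeAlgebra ℂ ConeGen → Prop
  | comm : Rel N q γ (genA * genB)
      (((q ^ N : ℝ) : ℂ) • (genB * genA) + ((γ * qInt q N : ℝ) : ℂ) • genB)
  | adjoint_comm : Rel N q γ (genBstar * genA)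
      (((q ^ N : ℝ) : ℂ) • (genA * genBstar) + ((γ * qInt q N : ℝ) : ℂ) • genBstar)
  | b_bstar : Rel N q γ (genB * genBstar)
      (Polynomial.aeval genA (∏ l ∈ Finset.range N, coneFactor q γ (-(l : ℤ))))
  | bstar_b : Rel N q γ (genBstar * genB)
      (Polynomial.aeval genA (∏ l ∈ Finset.Icc 1 N, coneFactor q γ (l : ℤ)))

end QuantumCone

/-- The (underlying complex algebra of the) coordinate `*`-algebra `O(C^N_{q,γ})` of the
quantum `N`-cone. -/
abbrev QuantumCone (N : ℕ) (q γ : ℝ) : Type := RingQuot (QuantumCone.Rel N q γ)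

end

-- Write `A` for the quantum cone and `B` for the quantum Weyl algebra generated by `x`, `y` with `y
-- x = q x y + γ`. The assignment `a ↦ x y`, `b ↦ x ^ N`, `b* ↦ y ^ N` identifies `A` with the
-- invariants of the order-`N` automorphism `θ : x ↦ ζ x, y ↦ ζ⁻¹ y`, where `ζ` is a primitive
-- `N`-th root of unity (`toWeyl_injective`, `cyclicAverage_mem_range`). The plan is to establish a
-- Koszul duality for `B` and let it descend to `A`.
--
-- For `B`: its basis `y ^ i x ^ j` makes a `q`-deformed Koszul complex `Bᵉ → Bᵉ × Bᵉ → Bᵉ` exact,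
-- with cokernel `B`. The dual complex is exact except at its end, where the cokernel is `B` twisted
-- by `x ↦ q⁻¹ x, y ↦ q y` (`exists_of_qKoszul`, `kε_eq_zero_iff`, `kψ_eq_zero_iff`).
--
-- Descent: in the `ℤ/N`-grading of `B` by eigenvalues of `θ`, the elements `y ^ g x ^ g` and `x ^
-- (N - g) y ^ (N - g)` are products of linear polynomials in `x y`. They are coprime precisely
-- because `γ ≠ 0` and `[l]_q ≠ 0` for `1 ≤ l < N` (`isCoprime_prod_coneFactor`). The Bézout
-- identities show that the grading is strong and provide dual bases for the averaging trace `B →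
-- A`, so `B` is a Frobenius extension of `A`, and `Bᵉ` is one of `Aᵉ`
-- (`CyclicTraceExtension.enveloping`).
--
-- Consequently each eigenspace of `Θ = θ ⊗ θ` on `Bᵉ` is a finitely generated projective
-- `Aᵉ`-module, and the trace pairs the eigenspaces for `c` and `c⁻¹` perfectly
-- (`eq_zero_of_dualMap`, `exists_dualMap_eq`). The invariant part of the Koszul complex is then a
-- projective resolution of `A` of length two, and its `Aᵉ`-dual is the invariant part of the dual
-- Koszul complex. This gives smoothness, vanishing of the other cohomology, and `A` with right
-- action twisted by `b ↦ q ^ (-N) b`, `b* ↦ q ^ N b*` in degree two.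

universe v

/-! ### Projective resolutions of length two. -/

section LengthTwoResolution

variable {R : Type v} [Ring R] {X : ModuleCat.{v} R} {P₀ P₁ P₂ : Type v}
  [AddCommGroup P₀] [AddCommGroup P₁] [AddCommGroup P₂]
  [Module R P₀] [Module R P₁] [Module R P₂]

/-- The chain complex `0 ⟶ P₂ ⟶ P₁ ⟶ P₀`. -/
noncomputable def lengthTwoComplex (d₂ : P₂ →ₗ[R] P₁) (d₁ : P₁ →ₗ[R] P₀)
    (h : d₁ ∘ₗ d₂ = 0) : ChainComplex (ModuleCat.{v} R) ℕ :=
  ChainComplex.mk (ModuleCat.of R P₀) (ModuleCat.of R P₁) (ModuleCat.of R P₂)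
    (ModuleCat.ofHom d₁) (ModuleCat.ofHom d₂)
    (by rw [← ModuleCat.ofHom_comp, h]; rfl)
    (fun _ => ⟨ModuleCat.of R PUnit.{v+1}, 0, Limits.zero_comp⟩)

theorem exists_projectiveResolution_of_exact (ε : P₀ →ₗ[R] X) (d₁ : P₁ →ₗ[R] P₀)
    (d₂ : P₂ →ₗ[R] P₁) [Module.Projective R P₀] [Module.Projective R P₁] [Module.Projective R P₂]
    [Module.Finite R P₀] [Module.Finite R P₁] [Module.Finite R P₂]
    (hε : Function.Surjective ε) (h₁ : Function.Exact d₁ ε) (h₂ : Function.Exact d₂ d₁)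
    (h₃ : Function.Injective d₂) :
    ∃ P : ProjectiveResolution X, (∀ i, Module.Finite R (P.complex.X i)) ∧
      ∃ n : ℕ, ∀ i, n < i → Limits.IsZero (P.complex.X i) := by
  have h21 : d₁ ∘ₗ d₂ = 0 := h₂.linearMap_comp_eq_zero
  let C := lengthTwoComplex d₂ d₁ h21
  have hz : ∀ n, Limits.IsZero (C.X (n + 3)) := fun n => by
    have : Subsingleton (C.X (n + 3)) := inferInstanceAs (Subsingleton PUnit.{v+1})
    exact ModuleCat.isZero_of_subsingleton _
  have hd : C.d 1 0 = ModuleCat.ofHom d₁ := ChainComplex.mk_d_1_0 ..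
  have hd' : C.d 2 1 = ModuleCat.ofHom d₂ := ChainComplex.mk_d_2_1 ..
  have hex : ∀ n, C.ExactAt (n + 1) := by
    intro n
    rw [HomologicalComplex.exactAt_iff' _ (n + 1 + 1) (n + 1) n (by simp) (by simp)]
    match n with
    | 0 =>
      rw [ShortComplex.ShortExact.moduleCat_exact_iff_function_exact]
      change Function.Exact (C.d 2 1).hom (C.d 1 0).hom
      rw [hd, hd']
      exact h₂
    | 1 =>
      rw [ShortComplex.moduleCat_exact_iff]
      intro x hx
      refine ⟨0, ?_⟩
      have : d₂ x = 0 := by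
        change (C.d 2 1).hom x = 0 at hx
        rwa [hd'] at hx
      rw [map_zero]
      exact (h₃ (this.trans (map_zero d₂).symm)).symm
    | n + 2 => exact ShortComplex.exact_of_isZero_X₂ _ (hz n)
  have hproj : ∀ n, Projective (C.X n) := by
    intro n
    match n with
    | 0 => exact ModuleCat.projective_of_categoryTheory_projective (ModuleCat.of R P₀)
    | 1 => exact ModuleCat.projective_of_categoryTheory_projective (ModuleCat.of R P₁)
    | 2 => exact ModuleCat.projective_of_categoryTheory_projective (ModuleCat.of R P₂)
    | n + 3 => exact (hz n).projective
  let π : C ⟶ (ChainComplex.single₀ _).obj X := (ChainComplex.toSingle₀Equiv C X).symm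
    ⟨ModuleCat.ofHom ε, by
      rw [hd]
      exact (ModuleCat.ofHom_comp _ _).symm.trans
        (by rw [h₁.linearMap_comp_eq_zero]; rfl)⟩
  refine ⟨{ complex := C, projective := hproj, π := π, quasiIso := ⟨fun n => ?_⟩ }, ?_, 2, ?_⟩
  · cases n
    · rw [ChainComplex.quasiIsoAt₀_iff, ShortComplex.quasiIso_iff_of_zeros']
      · have hw : ModuleCat.ofHom d₁ ≫ ModuleCat.ofHom ε = 0 := by
          rw [← ModuleCat.ofHom_comp, h₁.linearMap_comp_eq_zero]; rfl
        refine (ShortComplex.exact_and_epi_g_iff_of_iso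
          (S₂ := ShortComplex.mk (ModuleCat.ofHom d₁) (ModuleCat.ofHom ε) hw) ?_).2
          -- In degree zero, being a quasi-isomorphism means that `P₁ → P₀ → X → 0` is exact.
          ⟨(ShortComplex.ShortExact.moduleCat_exact_iff_function_exact _).2 h₁,
            (ModuleCat.epi_iff_surjective _).2 hε⟩
        exact ShortComplex.isoMk (Iso.refl _) (Iso.refl _) (Iso.refl _)
          (by simp [hd]; rfl) (by simp [π]; rfl)
      all_goals rfl
    · rw [quasiIsoAt_iff_exactAt']
      · apply hex
      · apply ChainComplex.exactAt_succ_single_obj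
  · intro i
    match i with
    | 0 => exact ‹Module.Finite R P₀›
    | 1 => exact ‹Module.Finite R P₁›
    | 2 => exact ‹Module.Finite R P₂›
    | n + 3 => exact inferInstanceAs (Module.Finite R PUnit.{v+1})
  · intro i hi
    obtain ⟨n, rfl⟩ := Nat.exists_eq_add_of_le hi
    rw [show 2 + 1 + n = n + 3 by ring]
    exact hz n

end LengthTwoResolution

/-! ### Ext groups computed from a length-two resolution in an abelian category. -/

section ExtOfLengthTwoResolution

open Abelian

variable {C : Type*} [Category C] [Abelian C] [HasExt.{v} C] {X K P₀ P₁ P₂ : C}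
  [Projective P₀] [Projective P₁]
  {i : K ⟶ P₀} {p : P₀ ⟶ X} {d : P₂ ⟶ P₁} {e : P₁ ⟶ K} {w : i ≫ p = 0} {w' : d ≫ e = 0}
  (h₁ : (ShortComplex.mk i p w).ShortExact) (h₂ : (ShortComplex.mk d e w').ShortExact) {Y : C}

include h₁ h₂

/-- Dimension shifting along the two short exact sequences into which the resolution is cut at the
syzygy `K`. Degrees at least three reduce to positive-degree Ext of the projective `P₂`; degrees
zero and one are the two exactness hypotheses on the dual complex. -/
theorem subsingleton_ext_of_lengthTwo [Projective P₂]
    (inj : ∀ f : P₀ ⟶ Y, (e ≫ i) ≫ f = 0 → f = 0)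
    (ex : ∀ g : P₁ ⟶ Y, d ≫ g = 0 → ∃ f : P₀ ⟶ Y, (e ≫ i) ≫ f = g)
    (n : ℕ) (hn : n ≠ 2) : Subsingleton (Ext.{v} X Y n) := by
  have : Epi e := h₂.epi_g
  have : Epi p := h₁.epi_g
  refine subsingleton_of_forall_eq 0 fun ξ => ?_
  match n with
  | 0 =>
    obtain ⟨f, rfl⟩ := Ext.addEquiv₀.symm.surjective ξ
    have : f = 0 := by
      rw [← cancel_epi p, inj (p ≫ f) (by simp [reassoc_of% w]), Limits.comp_zero]
    simp [this]
  | 1 =>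
    obtain ⟨η, rfl⟩ := Ext.contravariant_sequence_exact₃ h₁ Y ξ (Ext.eq_zero_of_projective _)
      (n₀ := 0) rfl
    obtain ⟨g, rfl⟩ := Ext.addEquiv₀.symm.surjective η
    -- The class comes from `g : K ⟶ Y`. Exactness of the dual complex extends `g` along `i` to
    -- `P₀`, and maps that extend have zero image under the connecting map.
    obtain ⟨f, hf⟩ := ex (e ≫ g) (by rw [reassoc_of% w', Limits.zero_comp])
    have : g = i ≫ f := by rw [← cancel_epi e, ← hf, Category.assoc]
    change h₁.extClass.comp (Ext.mk₀ g) _ = 0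
    rw [this, ← Ext.mk₀_comp_mk₀, ← Ext.comp_assoc_of_second_deg_zero]
    have := h₁.extClass_comp
    dsimp only at this
    rw [this, Ext.zero_comp]
  | n + 3 =>
    obtain ⟨η, rfl⟩ := Ext.contravariant_sequence_exact₃ h₁ Y ξ (Ext.eq_zero_of_projective _)
      (n₀ := n + 2) (by omega)
    obtain ⟨κ, rfl⟩ := Ext.contravariant_sequence_exact₃ h₂ Y η (Ext.eq_zero_of_projective _)
      (n₀ := n + 1) (by omega)
    rw [Ext.eq_zero_of_projective κ, Ext.comp_zero, Ext.comp_zero]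

/-- The second `Ext` group is the cokernel of `Hom(P₁, Y) ⟶ Hom(P₂, Y)`, compatibly with
endomorphisms of `Y`. -/
theorem exists_ext_two_equiv {M : Type*} [AddCommGroup M] (c : (P₂ ⟶ Y) →+ M)
    (hc : Function.Surjective c) (hker : ∀ f, c f = 0 ↔ ∃ g : P₁ ⟶ Y, d ≫ g = f) :
    ∃ E : Ext.{v} X Y 2 ≃+ M, ∀ (r : Y ⟶ Y) (ρ : M → M), (∀ f, c (f ≫ r) = ρ (c f)) →
      ∀ ξ : Ext.{v} X Y 2, E (ξ.comp (Ext.mk₀ r) (add_zero 2)) = ρ (E ξ) := by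
  -- The composite of the two connecting maps. It is onto because `P₀` and `P₁` have no higher Ext,
  -- so it suffices to match its kernel with that of `c`.
  let δ : (P₂ ⟶ Y) →+ Ext.{v} X Y 2 :=
    { toFun := fun f => h₁.extClass.comp (h₂.extClass.comp (Ext.mk₀ f) (add_zero 1)) rfl
      map_zero' := by simp
      map_add' := fun f g => by rw [Ext.mk₀_add, Ext.comp_add, Ext.comp_add] }
  have hδ : Function.Surjective δ := by
    intro ξ
    obtain ⟨η, rfl⟩ := Ext.contravariant_sequence_exact₃ h₁ Y ξ (Ext.eq_zero_of_projective _)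
      (n₀ := 1) rfl
    obtain ⟨κ, rfl⟩ := Ext.contravariant_sequence_exact₃ h₂ Y η (Ext.eq_zero_of_projective _)
      (n₀ := 0) rfl
    obtain ⟨g, rfl⟩ := Ext.addEquiv₀.symm.surjective κ
    exact ⟨g, rfl⟩
  have hker' : δ.ker = c.ker := by
    ext f
    rw [AddMonoidHom.mem_ker, AddMonoidHom.mem_ker, hker]
    constructor
    · intro hf
      obtain ⟨η, hη⟩ := Ext.contravariant_sequence_exact₁ h₁ Y _ (rfl : 1 + 1 = 2) hf
      have h0 : h₂.extClass.comp (Ext.mk₀ f) (add_zero 1) = 0 := by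
        rw [← hη, Ext.eq_zero_of_projective η, Ext.comp_zero]
      obtain ⟨κ, hκ⟩ := Ext.contravariant_sequence_exact₁ h₂ Y _ (add_zero 1) h0
      obtain ⟨g, rfl⟩ := Ext.addEquiv₀.symm.surjective κ
      refine ⟨g, ?_⟩
      apply Ext.addEquiv₀.symm.injective
      change Ext.mk₀ _ = Ext.mk₀ _
      rw [← hκ, ← Ext.mk₀_comp_mk₀]
      rfl
    · rintro ⟨g, rfl⟩
      change h₁.extClass.comp (h₂.extClass.comp (Ext.mk₀ _) (add_zero 1)) (rfl : 1 + 1 = 2) = 0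
      have := h₂.extClass_comp
      dsimp only at this
      rw [← Ext.mk₀_comp_mk₀, ← Ext.comp_assoc_of_second_deg_zero, this, Ext.zero_comp,
        Ext.comp_zero]
  let E : Ext.{v} X Y 2 ≃+ M := (QuotientAddGroup.quotientKerEquivOfSurjective δ hδ).symm.trans
    ((QuotientAddGroup.quotientAddEquivOfEq hker').trans
      (QuotientAddGroup.quotientKerEquivOfSurjective c hc))
  have hE : ∀ f, E (δ f) = c f := by
    intro f
    have : (QuotientAddGroup.quotientKerEquivOfSurjective δ hδ).symm (δ f) =
        QuotientAddGroup.mk f := by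
      rw [AddEquiv.symm_apply_eq]; rfl
    simp only [E, AddEquiv.trans_apply, this]
    rfl
  refine ⟨E, fun r ρ hr ξ => ?_⟩
  obtain ⟨f, rfl⟩ := hδ ξ
  have : (δ f).comp (Ext.mk₀ r) (add_zero 2) = δ (f ≫ r) := by
    change (h₁.extClass.comp (h₂.extClass.comp (Ext.mk₀ f) (add_zero 1)) (rfl : 1 + 1 = 2)).comp
      (Ext.mk₀ r) (add_zero 2) =
        h₁.extClass.comp (h₂.extClass.comp (Ext.mk₀ (f ≫ r)) (add_zero 1)) (rfl : 1 + 1 = 2)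
    rw [Ext.comp_assoc_of_third_deg_zero, Ext.comp_assoc_of_third_deg_zero, Ext.mk₀_comp_mk₀]
  rw [this, hE, hE, hr]

end ExtOfLengthTwoResolution

/-! ### The same computation for modules, with linear maps in place of morphisms. -/

section ModuleExt

open Abelian

variable {R : Type v} [Ring R] {X Y : ModuleCat.{v} R} {P₀ P₁ P₂ : Type v}
  [AddCommGroup P₀] [AddCommGroup P₁] [AddCommGroup P₂]
  [Module R P₀] [Module R P₁] [Module R P₂]
  (ε : P₀ →ₗ[R] X) (d₁ : P₁ →ₗ[R] P₀) (d₂ : P₂ →ₗ[R] P₁)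
  (hε : Function.Surjective ε) (h₁ : Function.Exact d₁ ε) (h₂ : Function.Exact d₂ d₁)
  (h₃ : Function.Injective d₂)

include hε h₁ h₂ h₃

/-- The syzygy is `ker ε`; the resolution is recovered by splicing the two sequences. -/
theorem exists_shortExact_splice :
    ∃ (K : ModuleCat.{v} R) (i : K ⟶ ModuleCat.of R P₀) (e : ModuleCat.of R P₁ ⟶ K)
      (w : i ≫ ModuleCat.ofHom ε = 0) (w' : ModuleCat.ofHom d₂ ≫ e = 0),
      (ShortComplex.mk i (ModuleCat.ofHom ε) w).ShortExact ∧
      (ShortComplex.mk (ModuleCat.ofHom d₂) e w').ShortExact ∧ e ≫ i = ModuleCat.ofHom d₁ := by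
  have h10 : ∀ x, d₁ x ∈ LinearMap.ker ε := fun x => h₁.apply_apply_eq_zero x
  refine ⟨ModuleCat.of R (LinearMap.ker ε), ModuleCat.ofHom (LinearMap.ker ε).subtype,
    ModuleCat.ofHom (d₁.codRestrict (LinearMap.ker ε) h10), ?_, ?_, ?_, ?_, rfl⟩
  · ext x; exact x.2
  · ext1
    exact LinearMap.ext fun x => Subtype.ext (h₂.apply_apply_eq_zero x)
  · refine ShortComplex.ShortExact.mk' ?_ ?_ ?_
    · rw [ShortComplex.ShortExact.moduleCat_exact_iff_function_exact]
      intro x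
      exact ⟨fun h => ⟨⟨x, h⟩, rfl⟩, by rintro ⟨y, rfl⟩; exact y.2⟩
    · exact (ModuleCat.mono_iff_injective _).2 Subtype.val_injective
    · exact (ModuleCat.epi_iff_surjective _).2 hε
  · refine ShortComplex.ShortExact.mk' ?_ ?_ ?_
    · rw [ShortComplex.ShortExact.moduleCat_exact_iff_function_exact]
      intro x
      refine Iff.trans ?_ (h₂ x)
      exact Subtype.ext_iff
    · exact (ModuleCat.mono_iff_injective _).2 h₃
    · refine (ModuleCat.epi_iff_surjective _).2 fun x => ?_
      obtain ⟨y, hy⟩ := (h₁ x.1).1 x.2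
      exact ⟨y, Subtype.ext hy⟩

variable [Module.Projective R P₀] [Module.Projective R P₁]

theorem subsingleton_ext_of_exact [Module.Projective R P₂] {Q : Type v} [AddCommGroup Q] [Module R Q]
    (inj : ∀ f : P₀ →ₗ[R] Q, f ∘ₗ d₁ = 0 → f = 0)
    (ex : ∀ g : P₁ →ₗ[R] Q, g ∘ₗ d₂ = 0 → ∃ f : P₀ →ₗ[R] Q, f ∘ₗ d₁ = g)
    (n : ℕ) (hn : n ≠ 2) : Subsingleton (Ext.{v} X (ModuleCat.of R Q) n) := by
  obtain ⟨K, i, e, w, w', s₁, s₂, hei⟩ := exists_shortExact_splice ε d₁ d₂ hε h₁ h₂ h₃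
  refine subsingleton_ext_of_lengthTwo s₁ s₂ ?_ ?_ n hn
  · intro f hf
    rw [hei] at hf
    ext1
    exact inj f.hom (congrArg ModuleCat.Hom.hom hf)
  · intro g hg
    obtain ⟨f, hf⟩ := ex g.hom (congrArg ModuleCat.Hom.hom hg)
    refine ⟨ModuleCat.ofHom f, ?_⟩
    rw [hei]
    ext1
    exact hf

theorem exists_ext_two_equiv_of_exact {Q : Type v} [AddCommGroup Q] [Module R Q]
    {M : Type*} [AddCommGroup M] (c : (P₂ →ₗ[R] Q) →+ M)
    (hc : Function.Surjective c) (hker : ∀ f, c f = 0 ↔ ∃ g : P₁ →ₗ[R] Q, g ∘ₗ d₂ = f) :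
    ∃ E : Ext.{v} X (ModuleCat.of R Q) 2 ≃+ M, ∀ (r : Q →ₗ[R] Q) (ρ : M → M),
      (∀ f, c (r ∘ₗ f) = ρ (c f)) → ∀ ξ : Ext.{v} X (ModuleCat.of R Q) 2,
        E (ξ.comp (Ext.mk₀ (ModuleCat.ofHom r)) (add_zero 2)) = ρ (E ξ) := by
  obtain ⟨K, i, e, w, w', s₁, s₂, hei⟩ := exists_shortExact_splice ε d₁ d₂ hε h₁ h₂ h₃
  obtain ⟨E, hE⟩ := exists_ext_two_equiv s₁ s₂ (Y := ModuleCat.of R Q)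
    (c.comp ModuleCat.homAddEquiv.toAddMonoidHom)
    (hc.comp ModuleCat.homAddEquiv.surjective) (fun f => by
      refine (hker f.hom).trans ⟨?_, ?_⟩
      · rintro ⟨g, hg⟩
        exact ⟨ModuleCat.ofHom g, by ext1; exact hg⟩
      · rintro ⟨g, hg⟩
        exact ⟨g.hom, congrArg ModuleCat.Hom.hom hg⟩)
  exact ⟨E, fun r ρ hr ξ => hE (ModuleCat.ofHom r) ρ (fun f => hr f.hom) ξ⟩

end ModuleExt

/-! ### Frobenius extensions with a cyclic automorphism: eigenspaces and their duality. -/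

/-- A Frobenius extension `S → E` of `k`-algebras, given by a trace `π` with dual bases, together
with an automorphism `Θ` of `E` of order dividing `N` which is the identity on `S` and
preserves the trace. -/
structure CyclicFrobeniusExtension (k : Type*) (S E : Type v) [Field k] [Ring S] [Ring E]
    [Algebra k S] [Algebra k E] [Module S E] where
  /-- The structure map. -/
  ι : S →ₐ[k] E
  smul_eq : ∀ (s : S) (e : E), s • e = ι s * e
  /-- The trace. -/
  π : E →ₗ[k] S
  π_mul_left : ∀ (s : S) (e : E), π (ι s * e) = s * π e
  π_mul_right : ∀ (s : S) (e : E), π (e * ι s) = π e * s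
  /-- The index set of the dual bases. -/
  ix : Type
  [fintype_ix : Fintype ix]
  /-- The first of the dual bases. -/
  u : ix → E
  /-- The second of the dual bases. -/
  v : ix → E
  left_dual : ∀ e : E, ∑ i, ι (π (e * u i)) * v i = e
  right_dual : ∀ e : E, ∑ i, u i * ι (π (v i * e)) = e
  /-- The order of the automorphism. -/
  N : ℕ
  N_ne_zero : (N : k) ≠ 0
  /-- The automorphism. -/
  Θ : E →ₐ[k] E
  Θ_pow : Θ ^ N = 1
  Θ_ι : ∀ s, Θ (ι s) = ι s
  π_Θ : ∀ e, π (Θ e) = π e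

namespace CyclicFrobeniusExtension

variable {k : Type*} {S E : Type v} [Field k] [Ring S] [Ring E]
  [Algebra k S] [Algebra k E] [Module S E] (F : CyclicFrobeniusExtension k S E)

attribute [instance] CyclicFrobeniusExtension.fintype_ix

/-- The eigenspace of `Θ` for the eigenvalue `c`. -/
def eigen (c : k) : Submodule S E where
  carrier := {w | F.Θ w = c • w}
  zero_mem' := by simp
  add_mem' {x y} hx hy := by
    simp only [Set.mem_ofPred_eq] at *
    rw [map_add, hx, hy, smul_add]
  smul_mem' s x hx := by
    simp only [Set.mem_ofPred_eq] at *
    rw [F.smul_eq, map_mul, F.Θ_ι, hx, mul_smul_comm]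

theorem mem_eigen {c : k} {w : E} : w ∈ F.eigen c ↔ F.Θ w = c • w := Iff.rfl

theorem mul_mem_eigen {c c' : k} {x y : E} (hx : x ∈ F.eigen c) (hy : y ∈ F.eigen c') :
    x * y ∈ F.eigen (c * c') := by
  rw [mem_eigen] at *
  rw [map_mul, hx, hy, smul_mul_smul_comm]

theorem ι_mem_eigen (s : S) : F.ι s ∈ F.eigen 1 := by
  rw [mem_eigen, F.Θ_ι, one_smul]

theorem Θ_pow_apply_of_mem {c : k} {w : E} (hw : w ∈ F.eigen c) (j : ℕ) :
    (F.Θ ^ j) w = c ^ j • w := by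
  induction j with
  | zero => simp
  | succ j ih =>
    rw [pow_succ', AlgHom.mul_apply, ih, map_smul, F.mem_eigen.1 hw, smul_smul, pow_succ]

/-- The projection to the eigenspace of `Θ` for the eigenvalue `c`. -/
def proj (c : k) : E →ₗ[k] E :=
  (F.N : k)⁻¹ • ∑ j ∈ Finset.range F.N, (c⁻¹ ^ j) • (F.Θ ^ j).toLinearMap

theorem proj_apply (c : k) (w : E) :
    F.proj c w = (F.N : k)⁻¹ • ∑ j ∈ Finset.range F.N, (c⁻¹ ^ j) • (F.Θ ^ j) w := by
  simp [proj, LinearMap.sum_apply]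

theorem proj_mem {c : k} (hc : c ^ F.N = 1) (w : E) : F.proj c w ∈ F.eigen c := by
  have hN : F.N ≠ 0 := fun h => F.N_ne_zero (by simp [h])
  have hc0 : c ≠ 0 := fun h => by simp [h, hN] at hc
  rw [mem_eigen, proj_apply, map_smul, map_sum, smul_comm]
  congr 1
  rw [Finset.smul_sum]
  have h : ∀ j, F.Θ ((c⁻¹ ^ j) • (F.Θ ^ j) w) = c • ((c⁻¹ ^ (j + 1)) • (F.Θ ^ (j + 1)) w) := by
    intro j
    rw [map_smul, pow_succ' F.Θ, AlgHom.mul_apply, smul_smul, pow_succ, mul_comm, mul_assoc,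
      inv_mul_cancel₀ hc0, mul_one]
  simp_rw [h]
  rw [← Finset.smul_sum, ← Finset.smul_sum]
  congr 1
  -- Applying `Θ` shifts the summation index by one; the sum is cyclic because the terms for `0` and
  -- `N` agree, both `Θ` and `c` having order dividing `N`.
  have h1 := Finset.sum_range_succ (fun j => (c⁻¹ ^ j) • (F.Θ ^ j) w) F.N
  rw [Finset.sum_range_succ', F.Θ_pow, inv_pow c F.N, hc] at h1
  simpa using h1

theorem proj_of_mem {c : k} (hc : c ^ F.N = 1) {w : E} (hw : w ∈ F.eigen c) :
    F.proj c w = w := by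
  have hN : F.N ≠ 0 := fun h => F.N_ne_zero (by simp [h])
  have hc0 : c ≠ 0 := fun h => by simp [h, hN] at hc
  have h : ∀ j, (c⁻¹ ^ j) • (F.Θ ^ j) w = w := fun j => by
    rw [F.Θ_pow_apply_of_mem hw, smul_smul, ← mul_pow, inv_mul_cancel₀ hc0, one_pow, one_smul]
  rw [proj_apply]
  simp_rw [h]
  rw [Finset.sum_const, Finset.card_range, ← Nat.cast_smul_eq_nsmul k, smul_smul,
    inv_mul_cancel₀ F.N_ne_zero, one_smul]

/-- Multiplication by an eigenvector shifts the grading. With `proj_mem_mul` this lets an equation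
in `E` be projected to one whose coefficients have the correct weights. -/
theorem proj_mul_of_mem {c c' : k} (w : E) {x : E} (hx : x ∈ F.eigen c') (hc' : c' ≠ 0) :
    F.proj (c * c') (w * x) = F.proj c w * x := by
  rw [proj_apply, proj_apply, smul_mul_assoc, Finset.sum_mul]
  congr 1
  refine Finset.sum_congr rfl fun j _ => ?_
  rw [map_mul, F.Θ_pow_apply_of_mem hx, mul_smul_comm, smul_mul_assoc, smul_smul, mul_inv,
    mul_pow, mul_assoc, ← mul_pow, inv_mul_cancel₀ hc', one_pow, mul_one]

theorem proj_mem_mul {c c' : k} (w : E) {x : E} (hx : x ∈ F.eigen c') (hc' : c' ≠ 0) :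
    F.proj (c * c') (x * w) = x * F.proj c w := by
  rw [proj_apply, proj_apply, mul_smul_comm, Finset.mul_sum]
  congr 1
  refine Finset.sum_congr rfl fun j _ => ?_
  rw [map_mul, F.Θ_pow_apply_of_mem hx, mul_smul_comm, smul_mul_assoc, smul_smul, mul_inv,
    mul_pow, mul_assoc, ← mul_pow, inv_mul_cancel₀ hc', one_pow, mul_one]

theorem π_proj_one (w : E) : F.π (F.proj 1 w) = F.π w := by
  have h : ∀ j, F.π ((F.Θ ^ j) w) = F.π w := by
    intro j
    induction j with
    | zero => simp
    | succ j ih => rw [pow_succ', AlgHom.mul_apply, F.π_Θ, ih]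
  rw [proj_apply, map_smul, map_sum]
  simp only [inv_one, one_pow, one_smul, h]
  rw [Finset.sum_const, Finset.card_range, ← Nat.cast_smul_eq_nsmul k, smul_smul,
    inv_mul_cancel₀ F.N_ne_zero, one_smul]

/-- The projection to an eigenspace as an `S`-linear map. -/
def projₗ {c : k} (hc : c ^ F.N = 1) : E →ₗ[S] F.eigen c where
  toFun w := ⟨F.proj c w, F.proj_mem hc w⟩
  map_add' x y := Subtype.ext (map_add _ x y)
  map_smul' s x := by
    apply Subtype.ext
    have := F.proj_mem_mul (c := c) x (F.ι_mem_eigen s) one_ne_zero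
    rw [mul_one] at this
    simp only [F.smul_eq, RingHom.id_apply, Submodule.coe_smul, this]

theorem projₗ_comp_subtype {c : k} (hc : c ^ F.N = 1) :
    F.projₗ hc ∘ₗ (F.eigen c).subtype = LinearMap.id :=
  LinearMap.ext fun w => Subtype.ext (F.proj_of_mem hc w.2)

/-- The functional `z ↦ π (z * w)`. -/
def dualMap (w : E) : E →ₗ[S] S where
  toFun z := F.π (z * w)
  map_add' x y := by rw [add_mul, map_add]
  map_smul' s x := by rw [F.smul_eq, mul_assoc, F.π_mul_left]; rfl

theorem dualMap_apply (w z : E) : F.dualMap w z = F.π (z * w) := rfl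

include F in
-- The first dual-basis identity says that `E` is a retract of the free module on the index set.
theorem projective : Module.Projective S E := by
  let i : E →ₗ[S] (F.ix → S) := LinearMap.pi fun j => F.dualMap (F.u j)
  let s : (F.ix → S) →ₗ[S] E :=
    ∑ j, (LinearMap.toSpanSingleton S E (F.v j)) ∘ₗ LinearMap.proj j
  refine Module.Projective.of_split i s (LinearMap.ext fun e => ?_)
  simp only [s, i, LinearMap.comp_apply, LinearMap.sum_apply, LinearMap.proj_apply,
    LinearMap.pi_apply, LinearMap.toSpanSingleton_apply, F.smul_eq, dualMap_apply,
    LinearMap.id_apply]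
  exact F.left_dual e

include F in
theorem finite : Module.Finite S E := by
  classical
  refine ⟨⟨Finset.univ.image F.v, ?_⟩⟩
  rw [eq_top_iff]
  intro e _
  rw [← F.left_dual e]
  refine Submodule.sum_mem _ fun i _ => ?_
  rw [← F.smul_eq]
  exact Submodule.smul_mem _ _ (Submodule.subset_span (by simp))

theorem projective_eigen {c : k} (hc : c ^ F.N = 1) : Module.Projective S (F.eigen c) :=
  have := F.projective
  Module.Projective.of_split _ _ (F.projₗ_comp_subtype hc)

theorem finite_eigen {c : k} (hc : c ^ F.N = 1) : Module.Finite S (F.eigen c) :=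
  have := F.finite
  Module.Finite.of_surjective (F.projₗ hc) fun w => ⟨w, Subtype.ext (F.proj_of_mem hc w.2)⟩

theorem π_proj_mul {c : k} (hc : c ^ F.N = 1) (z : E) {w : E} (hw : w ∈ F.eigen c⁻¹) :
    F.π (F.proj c z * w) = F.π (z * w) := by
  have hN : F.N ≠ 0 := fun h => F.N_ne_zero (by simp [h])
  have hc0 : c ≠ 0 := fun h => by simp [h, hN] at hc
  rw [← F.proj_mul_of_mem z hw (inv_ne_zero hc0), mul_inv_cancel₀ hc0, F.π_proj_one]

theorem π_mul_proj {c : k} (hc : c ^ F.N = 1) (w : E) {z : E} (hz : z ∈ F.eigen c) :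
    F.π (z * F.proj c⁻¹ w) = F.π (z * w) := by
  have hN : F.N ≠ 0 := fun h => F.N_ne_zero (by simp [h])
  have hc0 : c ≠ 0 := fun h => by simp [h, hN] at hc
  rw [← F.proj_mem_mul w hz hc0, inv_mul_cancel₀ hc0, F.π_proj_one]

/-- Nondegeneracy of the trace pairing between opposite eigenspaces. In the expansion of `w` in the
dual basis, each `v i` may be replaced by its component of weight `c`, since the trace sees only
total weight one. -/
theorem eq_zero_of_dualMap {c : k} (hc : c ^ F.N = 1) {w : E} (hw : w ∈ F.eigen c⁻¹)
    (h : ∀ z ∈ F.eigen c, F.π (z * w) = 0) : w = 0 := by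
  rw [← F.right_dual w]
  refine Finset.sum_eq_zero fun i _ => ?_
  rw [← F.π_proj_mul hc _ hw, h _ (F.proj_mem hc _), map_zero, mul_zero]

/-- The pairing is perfect: extend `f` to `E` through the projection, represent the extension by `∑
u i * ι (g (v i))`, and keep the component of weight `c⁻¹`. -/
theorem exists_dualMap_eq {c : k} (hc : c ^ F.N = 1) (f : F.eigen c →ₗ[S] S) :
    ∃ w ∈ F.eigen c⁻¹, ∀ z : F.eigen c, f z = F.π (z * w) := by
  have hc' : c⁻¹ ^ F.N = 1 := by rw [inv_pow, hc, inv_one]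
  let g : E →ₗ[S] S := f ∘ₗ F.projₗ hc
  refine ⟨F.proj c⁻¹ (∑ i, F.u i * F.ι (g (F.v i))), F.proj_mem hc' _, fun z => ?_⟩
  rw [F.π_mul_proj hc _ z.2]
  have h1 : f z = g z := by
    simp only [g, LinearMap.comp_apply]
    congr 1
    exact (LinearMap.congr_fun (F.projₗ_comp_subtype hc) z).symm
  rw [h1]
  conv_lhs => rw [← F.left_dual (z : E)]
  rw [map_sum, Finset.mul_sum, map_sum]
  refine Finset.sum_congr rfl fun i _ => ?_
  rw [← F.smul_eq, map_smul, ← mul_assoc, F.π_mul_right, smul_eq_mul]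

/-! ### The invariant part of a Koszul complex, and its dual. -/

section Koszul

open Abelian

variable {D : ModuleCat.{v} S} {M : Type*} [AddCommGroup M]

/-- Elements of `E` defining an exact Koszul complex `E → E × E → E` of left modules, an exact
dual complex, and modules `D` and `M` of coinvariants. -/
structure KoszulData (F : CyclicFrobeniusExtension k S E) (D : ModuleCat.{v} S) (M : Type*)
    [AddCommGroup M] where
  /-- A root of unity. -/
  ζ : k
  ζ_pow : ζ ^ F.N = 1
  (X Y X' Y' : E)
  X_mem : X ∈ F.eigen ζ
  Y_mem : Y ∈ F.eigen ζ⁻¹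
  X'_mem : X' ∈ F.eigen ζ
  Y'_mem : Y' ∈ F.eigen ζ⁻¹
  rel : Y' * X + X' * Y = 0
  exact_left : ∀ u v, u * X + v * Y = 0 → ∃ w, u = w * Y' ∧ v = w * X'
  injective_left : ∀ w, w * X' = 0 → w = 0
  exact_right : ∀ p r, Y' * p + X' * r = 0 → ∃ w, p = X * w ∧ r = Y * w
  injective_right : ∀ w, Y * w = 0 → w = 0
  /-- The augmentation of the Koszul complex. -/
  ε : F.eigen 1 →ₗ[S] D
  ε_surjective : Function.Surjective ε
  ε_eq_zero : ∀ z, ε z = 0 ↔ ∃ u v, (z : E) = u * X + v * Y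
  /-- The augmentation of the dual complex. -/
  ψ : F.eigen 1 →+ M
  ψ_surjective : Function.Surjective ψ
  ψ_eq_zero : ∀ z, ψ z = 0 ↔ ∃ p r, (z : E) = Y' * p + X' * r

namespace KoszulData

variable {F} (K : F.KoszulData D M)

theorem ζ_ne_zero : K.ζ ≠ 0 := fun h => by
  have hN : F.N ≠ 0 := fun h => F.N_ne_zero (by simp [h])
  have := K.ζ_pow
  simp [h, hN] at this

theorem ζ_inv_pow : K.ζ⁻¹ ^ F.N = 1 := by rw [inv_pow, K.ζ_pow, inv_one]

theorem mul_mem_of_eq {c c' d : k} {x y : E} (hx : x ∈ F.eigen c) (hy : y ∈ F.eigen c')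
    (h : c * c' = d) : x * y ∈ F.eigen d := h ▸ F.mul_mem_eigen hx hy

/-- The differential `(u, v) ↦ u * X + v * Y`. -/
def d₁ : (F.eigen K.ζ⁻¹ × F.eigen K.ζ) →ₗ[S] F.eigen 1 where
  toFun p := ⟨p.1 * K.X + p.2 * K.Y, add_mem
    (mul_mem_of_eq p.1.2 K.X_mem (inv_mul_cancel₀ K.ζ_ne_zero))
    (mul_mem_of_eq p.2.2 K.Y_mem (mul_inv_cancel₀ K.ζ_ne_zero))⟩
  map_add' x y := Subtype.ext (by
    simp only [Prod.fst_add, Prod.snd_add, Submodule.coe_add]; noncomm_ring)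
  map_smul' s x := Subtype.ext (by
    simp only [Prod.smul_fst, Prod.smul_snd, Submodule.coe_smul, F.smul_eq, RingHom.id_apply,
      mul_add, mul_assoc])

/-- The differential `w ↦ (w * Y', w * X')`. -/
def d₂ : F.eigen 1 →ₗ[S] (F.eigen K.ζ⁻¹ × F.eigen K.ζ) where
  toFun w := (⟨w * K.Y', mul_mem_of_eq w.2 K.Y'_mem (one_mul _)⟩,
    ⟨w * K.X', mul_mem_of_eq w.2 K.X'_mem (one_mul _)⟩)
  map_add' x y := Prod.ext (Subtype.ext (add_mul _ _ _)) (Subtype.ext (add_mul _ _ _))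
  map_smul' s x := by
    refine Prod.ext (Subtype.ext ?_) (Subtype.ext ?_) <;>
    simp only [Prod.smul_mk, Submodule.coe_smul, F.smul_eq, RingHom.id_apply, mul_assoc,
      SetLike.mk_smul_mk]

theorem coe_d₁ (p : F.eigen K.ζ⁻¹ × F.eigen K.ζ) :
    (K.d₁ p : E) = p.1 * K.X + p.2 * K.Y := rfl

theorem coe_d₂_fst (w : F.eigen 1) : ((K.d₂ w).1 : E) = w * K.Y' := rfl

theorem coe_d₂_snd (w : F.eigen 1) : ((K.d₂ w).2 : E) = w * K.X' := rfl

theorem d₂_injective : Function.Injective K.d₂ := by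
  refine (injective_iff_map_eq_zero _).2 fun w hw => Subtype.ext (K.injective_left _ ?_)
  rw [← coe_d₂_snd, hw]; rfl

theorem exact_d₂_d₁ : Function.Exact K.d₂ K.d₁ := by
  rintro ⟨u, v⟩
  constructor
  · intro h
    obtain ⟨w, hu, hv⟩ := K.exact_left u v (congrArg Subtype.val h)
    -- Exactness in `E` gives only some `w`. Since `w * X'` and `X'` have the same weight and `X'`
    -- can be cancelled, `w` is invariant.
    have hw : w ∈ F.eigen 1 := by
      rw [mem_eigen, one_smul, ← sub_eq_zero]
      apply K.injective_left
      have h1 : F.Θ (v : E) = K.ζ • (v : E) := v.2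
      rw [hv, map_mul, F.mem_eigen.1 K.X'_mem, mul_smul_comm] at h1
      have h2 := congrArg (K.ζ⁻¹ • ·) h1
      simp only [smul_smul, inv_mul_cancel₀ K.ζ_ne_zero, one_smul] at h2
      rw [sub_mul, h2, sub_self]
    exact ⟨⟨w, hw⟩, Prod.ext (Subtype.ext hu.symm) (Subtype.ext hv.symm)⟩
  · rintro ⟨w, hw⟩
    rw [← hw]
    apply Subtype.ext
    rw [coe_d₁, coe_d₂_fst, coe_d₂_snd, mul_assoc, mul_assoc, ← mul_add, K.rel, mul_zero]
    rfl

theorem exact_d₁_ε : Function.Exact K.d₁ K.ε := by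
  intro z
  rw [K.ε_eq_zero]
  constructor
  · rintro ⟨u, v, h⟩
    -- The coefficients may be replaced by their components of the right weight because `z` is
    -- invariant.
    refine ⟨(⟨F.proj K.ζ⁻¹ u, F.proj_mem K.ζ_inv_pow u⟩, ⟨F.proj K.ζ v, F.proj_mem K.ζ_pow v⟩),
      Subtype.ext ?_⟩
    rw [coe_d₁, ← F.proj_mul_of_mem u K.X_mem K.ζ_ne_zero,
      ← F.proj_mul_of_mem v K.Y_mem (inv_ne_zero K.ζ_ne_zero), inv_mul_cancel₀ K.ζ_ne_zero,
      mul_inv_cancel₀ K.ζ_ne_zero, ← map_add, ← h]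
    exact F.proj_of_mem (one_pow _) z.2
  · rintro ⟨p, rfl⟩
    exact ⟨p.1, p.2, rfl⟩

theorem projective_eigen_prod : Module.Projective S (F.eigen K.ζ⁻¹ × F.eigen K.ζ) :=
  have := F.projective_eigen K.ζ_pow
  have := F.projective_eigen K.ζ_inv_pow
  inferInstance

include K in
theorem exists_projectiveResolution :
    ∃ P : ProjectiveResolution D, (∀ i, Module.Finite S (P.complex.X i)) ∧
      ∃ n : ℕ, ∀ i, n < i → Limits.IsZero (P.complex.X i) := by
  have := F.projective_eigen (c := 1) (one_pow _)
  have := K.projective_eigen_prod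
  have := F.finite_eigen (c := 1) (one_pow _)
  have := F.finite_eigen K.ζ_pow
  have := F.finite_eigen K.ζ_inv_pow
  exact exists_projectiveResolution_of_exact K.ε K.d₁ K.d₂ K.ε_surjective K.exact_d₁_ε
    K.exact_d₂_d₁ K.d₂_injective

theorem exists_dual (f : F.eigen 1 →ₗ[S] S) :
    ∃ w : F.eigen (1 : k), ∀ z : F.eigen 1, f z = F.π (z * w) := by
  obtain ⟨w, hw, h⟩ := F.exists_dualMap_eq (one_pow _) f
  rw [inv_one] at hw
  exact ⟨⟨w, hw⟩, h⟩

/-- The element of `E` representing a functional on the invariants of `Θ`. -/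
noncomputable def dual (f : F.eigen 1 →ₗ[S] S) : F.eigen (1 : k) := (exists_dual f).choose

theorem dual_spec (f : F.eigen 1 →ₗ[S] S) (z : F.eigen (1 : k)) : f z = F.π (z * dual f) :=
  (exists_dual f).choose_spec z

theorem dual_eq {f : F.eigen 1 →ₗ[S] S} {w : F.eigen (1 : k)}
    (h : ∀ z : F.eigen (1 : k), f z = F.π (z * w)) : dual f = w := by
  apply Subtype.ext
  rw [← sub_eq_zero]
  refine F.eq_zero_of_dualMap (c := 1) (one_pow _) ?_ fun z hz => ?_
  · rw [inv_one]; exact sub_mem (dual f).2 w.2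
  · rw [mul_sub, map_sub, ← dual_spec f ⟨z, hz⟩, h ⟨z, hz⟩, sub_self]

theorem exists_dual_prod (g : (F.eigen K.ζ⁻¹ × F.eigen K.ζ) →ₗ[S] S) :
    ∃ (p : F.eigen K.ζ) (r : F.eigen K.ζ⁻¹), ∀ z, g z = F.π (z.1 * p) + F.π (z.2 * r) := by
  obtain ⟨p, hp, hp'⟩ := F.exists_dualMap_eq K.ζ_inv_pow (g ∘ₗ LinearMap.inl S _ _)
  obtain ⟨r, hr, hr'⟩ := F.exists_dualMap_eq K.ζ_pow (g ∘ₗ LinearMap.inr S _ _)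
  rw [inv_inv] at hp
  refine ⟨⟨p, hp⟩, ⟨r, hr⟩, fun z => ?_⟩
  rw [← hp', ← hr', LinearMap.comp_apply, LinearMap.comp_apply, ← map_add]
  simp

/-- Under the trace pairing, the transpose of right multiplication is left multiplication. Thus the
dual of the complex is the Koszul complex with the generators acting from the left. -/
theorem dual_comp_d₂_apply {g : (F.eigen K.ζ⁻¹ × F.eigen K.ζ) →ₗ[S] S} {p r : E}
    (h : ∀ z, g z = F.π (z.1 * p) + F.π (z.2 * r)) (z : F.eigen 1) :
    (g ∘ₗ K.d₂) z = F.π (z * (K.Y' * p + K.X' * r)) := by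
  rw [LinearMap.comp_apply, h, coe_d₂_fst, coe_d₂_snd, mul_add, map_add, mul_assoc, mul_assoc]

theorem Y'_mul_add_X'_mul_mem {p r : E} (hp : p ∈ F.eigen K.ζ) (hr : r ∈ F.eigen K.ζ⁻¹) :
    K.Y' * p + K.X' * r ∈ F.eigen 1 :=
  add_mem (mul_mem_of_eq K.Y'_mem hp (inv_mul_cancel₀ K.ζ_ne_zero))
    (mul_mem_of_eq K.X'_mem hr (mul_inv_cancel₀ K.ζ_ne_zero))

theorem eq_zero_of_comp_d₁ (f : F.eigen 1 →ₗ[S] S) (hf : f ∘ₗ K.d₁ = 0) : f = 0 := by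
  have h : K.Y * (dual f : E) = 0 := by
    refine F.eq_zero_of_dualMap K.ζ_pow (mul_mem_of_eq K.Y_mem (dual f).2 (mul_one _))
      fun z hz => ?_
    have := LinearMap.congr_fun hf (0, ⟨z, hz⟩)
    rw [LinearMap.comp_apply, dual_spec, coe_d₁] at this
    simpa [mul_assoc] using this
  ext z
  rw [dual_spec, K.injective_right _ h]
  simp

theorem exists_comp_d₁ (g : (F.eigen K.ζ⁻¹ × F.eigen K.ζ) →ₗ[S] S) (hg : g ∘ₗ K.d₂ = 0) :
    ∃ f : F.eigen 1 →ₗ[S] S, f ∘ₗ K.d₁ = g := by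
  obtain ⟨p, r, h⟩ := K.exists_dual_prod g
  have h0 : K.Y' * (p : E) + K.X' * r = 0 := by
    refine F.eq_zero_of_dualMap (c := 1) (one_pow _)
      (by rw [inv_one]; exact K.Y'_mul_add_X'_mul_mem p.2 r.2) fun z hz => ?_
    rw [← K.dual_comp_d₂_apply h ⟨z, hz⟩, hg]; rfl
  obtain ⟨w, hp, hr⟩ := K.exact_right _ _ h0
  refine ⟨F.dualMap w ∘ₗ (F.eigen 1).subtype, LinearMap.ext fun z => ?_⟩
  rw [h, LinearMap.comp_apply, LinearMap.comp_apply, dualMap_apply, Submodule.subtype_apply,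
    coe_d₁, hp, hr, add_mul, map_add, mul_assoc, mul_assoc]

include K in
theorem subsingleton_ext (n : ℕ) (hn : n ≠ 2) :
    Subsingleton (Ext.{v} D (ModuleCat.of S S) n) :=
  have := F.projective_eigen (c := 1) (one_pow _)
  have := K.projective_eigen_prod
  subsingleton_ext_of_exact K.ε K.d₁ K.d₂ K.ε_surjective K.exact_d₁_ε
    K.exact_d₂_d₁ K.d₂_injective K.eq_zero_of_comp_d₁ K.exists_comp_d₁ n hn

/-- The augmentation of the dual complex, on functionals. -/
noncomputable def dualAugmentation : (F.eigen (1 : k) →ₗ[S] S) →+ M where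
  toFun f := K.ψ (dual f)
  map_zero' := by
    rw [dual_eq (w := 0), map_zero]
    intro z; simp
  map_add' f g := by
    rw [← map_add]
    congr 1
    refine dual_eq fun z => ?_
    rw [LinearMap.add_apply, dual_spec f, dual_spec g, Submodule.coe_add, mul_add, map_add]

/-- Right multiplication by `s` on the coefficients corresponds, under the trace pairing, to right
multiplication by `ι s` on representing elements. This carries the bimodule structure of Ext over to
`M`. -/
theorem exists_ext_two_equiv :
    ∃ e : Ext.{v} D (ModuleCat.of S S) 2 ≃+ M, ∀ (s : S) (ρ : M → M),
      (∀ z : F.eigen (1 : k), K.ψ ⟨z * F.ι s, mul_mem_of_eq z.2 (F.ι_mem_eigen s) (one_mul 1)⟩ =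
        ρ (K.ψ z)) →
      ∀ ξ, e (ξ.comp (Ext.mk₀ (ModuleCat.ofHom (LinearMap.toSpanSingleton S S s))) (add_zero 2)) =
        ρ (e ξ) := by
  have := F.projective_eigen (c := 1) (one_pow _)
  have := K.projective_eigen_prod
  have hsurj : Function.Surjective K.dualAugmentation := by
    intro m
    obtain ⟨w, rfl⟩ := K.ψ_surjective m
    refine ⟨F.dualMap w ∘ₗ (F.eigen 1).subtype, ?_⟩
    change K.ψ _ = _
    rw [dual_eq (w := w) fun z => rfl]
  have hker : ∀ f, K.dualAugmentation f = 0 ↔ ∃ g, g ∘ₗ K.d₂ = f := by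
    intro f
    change K.ψ _ = 0 ↔ _
    rw [K.ψ_eq_zero]
    constructor
    · rintro ⟨p, r, h⟩
      have h' : (dual f : E) = K.Y' * F.proj K.ζ p + K.X' * F.proj K.ζ⁻¹ r := by
        rw [← F.proj_mem_mul p K.Y'_mem (inv_ne_zero K.ζ_ne_zero),
          ← F.proj_mem_mul r K.X'_mem K.ζ_ne_zero, inv_mul_cancel₀ K.ζ_ne_zero,
          mul_inv_cancel₀ K.ζ_ne_zero, ← map_add, ← h]
        exact (F.proj_of_mem (one_pow _) (dual f).2).symm
      refine ⟨(F.dualMap (F.proj K.ζ p) ∘ₗ (F.eigen K.ζ⁻¹).subtype).coprod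
        (F.dualMap (F.proj K.ζ⁻¹ r) ∘ₗ (F.eigen K.ζ).subtype), LinearMap.ext fun z => ?_⟩
      rw [K.dual_comp_d₂_apply (p := F.proj K.ζ p) (r := F.proj K.ζ⁻¹ r) fun z => rfl, ← h',
        ← dual_spec]
    · rintro ⟨g, rfl⟩
      obtain ⟨p, r, h⟩ := K.exists_dual_prod g
      refine ⟨p, r, ?_⟩
      rw [dual_eq (w := ⟨_, K.Y'_mul_add_X'_mul_mem p.2 r.2⟩) (K.dual_comp_d₂_apply h)]
  obtain ⟨e, he⟩ := exists_ext_two_equiv_of_exact K.ε K.d₁ K.d₂ K.ε_surjective K.exact_d₁_ε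
    K.exact_d₂_d₁ K.d₂_injective K.dualAugmentation (Q := S) hsurj hker
  refine ⟨e, fun s ρ hρ ξ => he _ ρ (fun f => ?_) ξ⟩
  change K.ψ _ = ρ (K.ψ _)
  rw [← hρ]
  congr 1
  refine dual_eq fun z => ?_
  rw [LinearMap.comp_apply, LinearMap.toSpanSingleton_apply, smul_eq_mul, dual_spec f,
    ← F.π_mul_right, mul_assoc]

end KoszulData

end Koszul

end CyclicFrobeniusExtension

/-! ### Exactness of a `q`-deformed Koszul complex on a tensor product. -/

section QKoszul

variable {k U V : Type*} [Field k] [AddCommGroup U] [Module k U] [AddCommGroup V] [Module k V]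

/-- Iterating gives `f j = g ^ m (f (j + m))`, which vanishes for large `m`. This descent replaces
any torsion-freeness assumption on `V`. -/
theorem eq_zero_of_finite_of_step {V : Type*} [AddCommGroup V] [Module k V] (g : V →ₗ[k] V)
    (f : ℕ → V) (n : ℕ) (hn : ∀ j, n ≤ j → f j = 0) (h : ∀ j, f j = g (f (j + 1))) (j : ℕ) :
    f j = 0 := by
  have key : ∀ m j, n ≤ j + m → f j = 0 := by
    intro m
    induction m with
    | zero => exact hn
    | succ m ih =>
      intro j hj
      rw [h, ih (j + 1) (by omega), map_zero]
  exact key n j (by omega)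

variable (e : Module.Basis (ℕ × ℕ) k U)

/-- The coefficient in `V` of an element of `U ⊗ V` at a basis vector of `U`. -/
noncomputable def tensorCoeff (i j : ℕ) : U ⊗[k] V →ₗ[k] V :=
  Finsupp.lapply (i, j) ∘ₗ (TensorProduct.equivFinsuppOfBasisLeft e).toLinearMap

theorem tensorCoeff_tmul (i j : ℕ) (p : ℕ × ℕ) (v : V) :
    tensorCoeff e i j (e p ⊗ₜ[k] v) = if p = (i, j) then v else 0 := by
  classical
  simp [tensorCoeff, TensorProduct.equivFinsuppOfBasisLeft_apply_tmul, Finsupp.single_apply]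

theorem eq_zero_of_tensorCoeff {m : U ⊗[k] V} (h : ∀ i j, tensorCoeff e i j m = 0) : m = 0 :=
  (TensorProduct.equivFinsuppOfBasisLeft (N := V) e).map_eq_zero_iff.1
    (Finsupp.ext fun p => h p.1 p.2)

theorem exists_tensorCoeff_eq_zero (m : U ⊗[k] V) (i : ℕ) :
    ∃ n, ∀ j, n ≤ j → tensorCoeff e i j m = 0 := by
  let s := (TensorProduct.equivFinsuppOfBasisLeft e m).support.image Prod.snd
  refine ⟨s.sup id + 1, fun j hj => ?_⟩
  by_contra hne
  have : j ∈ s := Finset.mem_image.2 ⟨(i, j), Finsupp.mem_support_iff.2 hne, rfl⟩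
  have := Finset.le_sup (f := id) this
  simp only [id] at this
  omega

theorem tensor_basis_ext {W : Type*} [AddCommGroup W] [Module k W] {f g : U ⊗[k] V →ₗ[k] W}
    (h : ∀ p v, f (e p ⊗ₜ v) = g (e p ⊗ₜ v)) : f = g :=
  TensorProduct.ext (e.ext fun p => LinearMap.ext fun v => h p v)

variable {ξ η : U →ₗ[k] U} (hξ : ∀ i j, ξ (e (i, j)) = e (i, j + 1))
  (hη : ∀ i, η (e (i, 0)) = e (i + 1, 0)) (ξ' η' : V →ₗ[k] V)

theorem tensorCoeff_lTensor (i j : ℕ) (m : U ⊗[k] V) :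
    tensorCoeff e i j (ξ'.lTensor U m) = ξ' (tensorCoeff e i j m) := by
  have : tensorCoeff e i j ∘ₗ ξ'.lTensor U = ξ' ∘ₗ tensorCoeff e i j := by
    refine tensor_basis_ext e fun p v => ?_
    simp only [LinearMap.comp_apply, LinearMap.lTensor_tmul, tensorCoeff_tmul]
    split_ifs <;> simp
  exact LinearMap.congr_fun this m

include hξ in
theorem tensorCoeff_rTensor_succ (i j : ℕ) (m : U ⊗[k] V) :
    tensorCoeff e i (j + 1) (ξ.rTensor V m) = tensorCoeff e i j m := by
  have : tensorCoeff e i (j + 1) ∘ₗ ξ.rTensor V = tensorCoeff e i j := by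
    refine tensor_basis_ext e fun p v => ?_
    obtain ⟨a, b⟩ := p
    simp only [LinearMap.comp_apply, LinearMap.rTensor_tmul, hξ, tensorCoeff_tmul]
    simp
  exact LinearMap.congr_fun this m

include hξ in
-- The hypothesis says that the coefficient at `(i, j)` is `ξ'` of the coefficient at `(i, j + 1)`,
-- so finite support forces zero. The coefficients at `j = 0` of the difference are never needed.
theorem eq_zero_of_rTensor_sub_lTensor {m : U ⊗[k] V}
    (h : ∀ i j, tensorCoeff e i (j + 1) (ξ.rTensor V m - ξ'.lTensor U m) = 0) : m = 0 := by
  refine eq_zero_of_tensorCoeff e fun i j => ?_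
  obtain ⟨n, hn⟩ := exists_tensorCoeff_eq_zero e m i
  refine eq_zero_of_finite_of_step ξ' (fun j => tensorCoeff e i j m) n hn (fun j => ?_) j
  have := h i j
  rwa [map_sub, tensorCoeff_rTensor_succ e hξ, tensorCoeff_lTensor, sub_eq_zero] at this

/-- The map `(vᵢ) ↦ ∑ e (i, 0) ⊗ vᵢ`. -/
noncomputable def rowZero : (ℕ →₀ V) →ₗ[k] U ⊗[k] V :=
  Finsupp.lsum ℕ fun i => TensorProduct.mk k U V (e (i, 0))

theorem rowZero_single (i : ℕ) (v : V) :
    rowZero e (Finsupp.single i v) = e (i, 0) ⊗ₜ[k] v := by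
  simp [rowZero]

theorem tensorCoeff_rowZero (i : ℕ) (f : ℕ →₀ V) : tensorCoeff e i 0 (rowZero e f) = f i := by
  have : tensorCoeff e i 0 ∘ₗ rowZero e = Finsupp.lapply (M := V) i := by
    refine Finsupp.lhom_ext fun a v => ?_
    classical
    simp [rowZero_single, tensorCoeff_tmul, Finsupp.single_apply]
  exact LinearMap.congr_fun this f

theorem tensorCoeff_succ_rowZero (i j : ℕ) (f : ℕ →₀ V) :
    tensorCoeff e i (j + 1) (rowZero e f) = 0 := by
  have : tensorCoeff e i (j + 1) ∘ₗ rowZero (V := V) e = 0 := by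
    refine Finsupp.lhom_ext fun a v => ?_
    simp [rowZero_single, tensorCoeff_tmul]
  exact LinearMap.congr_fun this f

include hη in
theorem tensorCoeff_rTensor_rowZero (i : ℕ) (f : ℕ →₀ V) :
    tensorCoeff e (i + 1) 0 (η.rTensor V (rowZero e f)) = f i := by
  have : tensorCoeff e (i + 1) 0 ∘ₗ η.rTensor V ∘ₗ rowZero e = Finsupp.lapply (M := V) i := by
    refine Finsupp.lhom_ext fun a v => ?_
    classical
    simp [rowZero_single, tensorCoeff_tmul, Finsupp.single_apply, hη]
  exact LinearMap.congr_fun this f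

include hη in
theorem tensorCoeff_succ_rTensor_rowZero (i j : ℕ) (f : ℕ →₀ V) :
    tensorCoeff e i (j + 1) (η.rTensor V (rowZero e f)) = 0 := by
  have : tensorCoeff e i (j + 1) ∘ₗ η.rTensor V ∘ₗ rowZero (V := V) e = 0 := by
    refine Finsupp.lhom_ext fun a v => ?_
    simp [rowZero_single, tensorCoeff_tmul, hη]
  exact LinearMap.congr_fun this f

include hη in
theorem rowZero_eq_zero {f : ℕ →₀ V}
    (h : η.rTensor V (rowZero e f) - η'.lTensor U (rowZero e f) = 0) : f = 0 := by
  ext i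
  refine eq_zero_of_finite_of_step η' f (f.support.sup id + 1) (fun j hj => ?_) (fun j => ?_) i
  · by_contra hne
    have := Finset.le_sup (f := id) (Finsupp.mem_support_iff.2 hne)
    simp only [id] at this
    omega
  · have := congrArg (tensorCoeff e (j + 1) 0) h
    rwa [map_sub, map_zero, tensorCoeff_rTensor_rowZero e hη, tensorCoeff_lTensor,
      tensorCoeff_rowZero, sub_eq_zero] at this

variable {q γ : k} (hq : q ≠ 0)

include hξ hq in
-- Modulo the image of `ξ' - q ξ`, one has `e (i, j + 1) ⊗ v ≡ q⁻¹ e (i, j) ⊗ ξ' v`, so everything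
-- can be pushed down to row zero.
theorem exists_eq_add_rowZero (m : U ⊗[k] V) :
    ∃ (m' : U ⊗[k] V) (f : ℕ →₀ V),
      m = (ξ'.lTensor U m' - q • ξ.rTensor V m') + rowZero e f := by
  let R : Submodule k (U ⊗[k] V) :=
    LinearMap.range (ξ'.lTensor U - q • ξ.rTensor V) ⊔ LinearMap.range (rowZero e)
  suffices h : m ∈ R by
    obtain ⟨_, ⟨m', rfl⟩, _, ⟨f, rfl⟩, h⟩ := Submodule.mem_sup.1 h
    exact ⟨m', f, h.symm⟩
  have key : ∀ i j v, e (i, j) ⊗ₜ[k] v ∈ R := by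
    intro i j
    induction j with
    | zero => exact fun v => Submodule.mem_sup_right ⟨Finsupp.single i v, rowZero_single e i v⟩
    | succ j ih =>
      intro v
      have h1 : (ξ'.lTensor U - q • ξ.rTensor V) (e (i, j) ⊗ₜ[k] v) ∈ R :=
        Submodule.mem_sup_left ⟨_, rfl⟩
      have h2 := R.smul_mem q⁻¹ (R.sub_mem (ih (ξ' v)) h1)
      simpa [hξ, smul_smul, hq] using h2
  induction m with
  | zero => exact R.zero_mem
  | add x y hx hy => exact R.add_mem hx hy
  | tmul u v =>
    have : LinearMap.range ((TensorProduct.mk k U V).flip v) ≤ R := by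
      rw [LinearMap.range_eq_map, ← e.span_eq, Submodule.map_span_le]
      rintro _ ⟨p, rfl⟩
      exact key p.1 p.2 v
    exact this ⟨u, rfl⟩

variable (hU : ∀ u, ξ (η u) = q • η (ξ u) + γ • u) (hV : ∀ v, η' (ξ' v) = q • ξ' (η' v) + γ • v)

include hξ hη hq hU hV in
/-- Exactness in the middle of the `q`-deformed Koszul complex on `U ⊗ V`. -/
theorem exists_of_qKoszul {u v : U ⊗[k] V}
    (h : (ξ.rTensor V u - ξ'.lTensor U u) + (η.rTensor V v - η'.lTensor U v) = 0) :
    ∃ w, u = η.rTensor V w - q • η'.lTensor U w ∧ v = ξ'.lTensor U w - q • ξ.rTensor V w := by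
  -- Subtracting the boundary of `m` reduces `v` to row zero; it is then shown that what remains of
  -- both components is zero.
  obtain ⟨m, f, rfl⟩ := exists_eq_add_rowZero e hξ ξ' hq v
  have hrel : (ξ.rTensor V - ξ'.lTensor U) ∘ₗ (η.rTensor V - q • η'.lTensor U) +
      (η.rTensor V - η'.lTensor U) ∘ₗ (ξ'.lTensor U - q • ξ.rTensor V) = 0 := by
    refine TensorProduct.ext' fun a b => ?_
    simp only [LinearMap.add_apply, LinearMap.comp_apply, LinearMap.sub_apply,
      LinearMap.smul_apply, LinearMap.rTensor_tmul, LinearMap.lTensor_tmul, map_sub, map_smul,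
      LinearMap.zero_apply, hU, hV, TensorProduct.add_tmul, TensorProduct.tmul_add,
      ← TensorProduct.smul_tmul', TensorProduct.tmul_smul]
    module
  have hrel' := LinearMap.congr_fun hrel m
  simp only [LinearMap.add_apply, LinearMap.comp_apply, LinearMap.sub_apply,
      LinearMap.smul_apply, LinearMap.zero_apply] at hrel'
  have h' : ξ.rTensor V (u - (η.rTensor V m - q • η'.lTensor U m)) -
      ξ'.lTensor U (u - (η.rTensor V m - q • η'.lTensor U m)) =
      -(η.rTensor V (rowZero e f) - η'.lTensor U (rowZero e f)) := by
    rw [← sub_eq_zero, ← sub_eq_zero.2 (h.trans hrel'.symm)]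
    simp only [map_sub, map_add, map_smul]
    module
  -- The right side of `h'` lives in row zero, because `η` and `η'` preserve that row; the
  -- coefficients with `j ≥ 1` therefore vanish.
  have h0 : u - (η.rTensor V m - q • η'.lTensor U m) = 0 := by
    refine eq_zero_of_rTensor_sub_lTensor e hξ ξ' fun i j => ?_
    rw [h', map_neg, map_sub, tensorCoeff_succ_rTensor_rowZero e hη, tensorCoeff_lTensor,
      tensorCoeff_succ_rowZero, map_zero, sub_zero, neg_zero]
  rw [h0, map_zero, map_zero, sub_zero, eq_comm, neg_eq_zero] at h'
  have hf := rowZero_eq_zero e hη η' h'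
  exact ⟨m, sub_eq_zero.1 h0, by rw [hf, map_zero, add_zero]⟩

include hξ hq in
theorem eq_zero_of_lTensor_sub_smul_rTensor {w : U ⊗[k] V}
    (h : ξ'.lTensor U w - q • ξ.rTensor V w = 0) : w = 0 := by
  refine eq_zero_of_rTensor_sub_lTensor e hξ (q⁻¹ • ξ') fun i j => ?_
  have : ξ.rTensor V w - (q⁻¹ • ξ').lTensor U w = 0 := by
    rw [LinearMap.lTensor_smul, LinearMap.smul_apply, sub_eq_zero.1 h, smul_smul,
      inv_mul_cancel₀ hq, one_smul, sub_self]
  rw [this, map_zero]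

end QKoszul

theorem Submodule.eq_top_of_adjoin_mul_mem {k C : Type*} [CommSemiring k] [Semiring C]
    [Algebra k C] {s : Set C} (hs : Algebra.adjoin k s = ⊤) (R : Submodule k C) (h1 : (1 : C) ∈ R)
    (hR : ∀ a ∈ s, ∀ r ∈ R, a * r ∈ R) : R = ⊤ := by
  have key : ∀ c ∈ Algebra.adjoin k s, ∀ r ∈ R, c * r ∈ R := by
    intro c hc
    induction hc using Algebra.adjoin_induction with
    | mem a ha => exact hR a ha
    | algebraMap t =>
      intro r hr
      rw [← Algebra.smul_def]
      exact R.smul_mem t hr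
    | add a b _ _ ha hb =>
      intro r hr
      rw [add_mul]
      exact R.add_mem (ha r hr) (hb r hr)
    | mul a b _ _ ha hb =>
      intro r hr
      rw [mul_assoc]
      exact ha _ (hb r hr)
  rw [eq_top_iff]
  intro c _
  have := key c (hs ▸ Algebra.mem_top) 1 h1
  rwa [mul_one] at this

theorem RingQuot.adjoin_range_mkAlgHom_ι {k I : Type*} [CommRing k]
    (r : FreeAlgebra k I → FreeAlgebra k I → Prop) :
    Algebra.adjoin k (Set.range fun i => RingQuot.mkAlgHom k r (FreeAlgebra.ι k i)) = ⊤ := by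
  have h : (Set.range fun i => RingQuot.mkAlgHom k r (FreeAlgebra.ι k i)) =
      RingQuot.mkAlgHom k r '' Set.range (FreeAlgebra.ι k) := by
    rw [← Set.range_comp]; rfl
  rw [h, ← AlgHom.map_adjoin, FreeAlgebra.adjoin_range_ι, Algebra.map_top, AlgHom.range_eq_top]
  exact RingQuot.mkAlgHom_surjective k r

/-! ### The quantum Weyl algebra -/

/-- The defining relation `y x = q x y + γ` of the quantum Weyl algebra; `false` and `true`
index the generators `x` and `y`. -/
inductive QWeyl.Rel {k : Type*} [Field k] (q γ : k) :
    FreeAlgebra k Bool → FreeAlgebra k Bool → Prop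
  | comm : QWeyl.Rel q γ (FreeAlgebra.ι k true * FreeAlgebra.ι k false)
      (q • (FreeAlgebra.ι k false * FreeAlgebra.ι k true) + algebraMap k _ γ)

/-- The quantum Weyl algebra, generated by `x` and `y` with `y x = q x y + γ`. -/
def QWeyl {k : Type*} [Field k] (q γ : k) : Type _ := RingQuot (QWeyl.Rel q γ)

namespace QWeyl

variable {k : Type*} [Field k] (q γ : k)

noncomputable instance : Ring (QWeyl q γ) := inferInstanceAs (Ring (RingQuot (Rel q γ)))

noncomputable instance : Algebra k (QWeyl q γ) :=
  inferInstanceAs (Algebra k (RingQuot (Rel q γ)))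

/-- The quotient map from the free algebra. -/
noncomputable def mk : FreeAlgebra k Bool →ₐ[k] QWeyl q γ := RingQuot.mkAlgHom k (Rel q γ)

/-- The generator `x`. -/
noncomputable def x : QWeyl q γ := mk q γ (FreeAlgebra.ι k false)

/-- The generator `y`. -/
noncomputable def y : QWeyl q γ := mk q γ (FreeAlgebra.ι k true)

theorem y_mul_x : y q γ * x q γ = q • (x q γ * y q γ) + algebraMap k _ γ := by
  have : mk q γ _ = mk q γ _ := RingQuot.mkAlgHom_rel k (Rel.comm (q := q) (γ := γ))
  rw [map_mul, map_add, map_smul, map_mul, AlgHom.commutes] at this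
  exact this

variable {q γ}

section Lift

variable {C : Type*} [Ring C] [Algebra k C]

/-- The universal property of the quantum Weyl algebra. -/
noncomputable def lift (X Y : C) (h : Y * X = q • (X * Y) + algebraMap k C γ) :
    QWeyl q γ →ₐ[k] C :=
  RingQuot.liftAlgHom k ⟨FreeAlgebra.lift k fun b => if b then Y else X, by
    rintro _ _ ⟨⟩
    simpa using h⟩

variable {X Y : C} (h : Y * X = q • (X * Y) + algebraMap k C γ)

@[simp]
theorem lift_x : lift X Y h (x q γ) = X :=
  (RingQuot.liftAlgHom_mkAlgHom_apply ..).trans (by simp)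

@[simp]
theorem lift_y : lift X Y h (y q γ) = Y :=
  (RingQuot.liftAlgHom_mkAlgHom_apply ..).trans (by simp)

theorem hom_ext {f g : QWeyl q γ →ₐ[k] C} (hx : f (x q γ) = g (x q γ))
    (hy : f (y q γ) = g (y q γ)) : f = g := by
  refine RingQuot.ringQuot_ext' k f g
    (FreeAlgebra.hom_ext (funext fun b => ?_))
  cases b
  · exact hx
  · exact hy

end Lift

theorem adjoin_eq_top : Algebra.adjoin k {x q γ, y q γ} = ⊤ := by
  have := RingQuot.adjoin_range_mkAlgHom_ι (Rel q γ)
  refine Eq.trans ?_ this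
  have h : ({x q γ, y q γ} : Set (QWeyl q γ)) =
      Set.range fun i => mk q γ (FreeAlgebra.ι k i) := by
    ext b
    simp [x, y]
  rw [h]
  rfl

/-- The rescaling `x ↦ c x`, `y ↦ c⁻¹ y`. -/
noncomputable def scale {c : k} (hc : c ≠ 0) : QWeyl q γ →ₐ[k] QWeyl q γ :=
  lift (c • x q γ) (c⁻¹ • y q γ) (by
    rw [smul_mul_smul_comm, smul_mul_smul_comm, inv_mul_cancel₀ hc, mul_inv_cancel₀ hc, one_smul,
      one_smul, y_mul_x])

@[simp]
theorem scale_x {c : k} (hc : c ≠ 0) : scale hc (x q γ) = c • x q γ := lift_x _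

@[simp]
theorem scale_y {c : k} (hc : c ≠ 0) : scale hc (y q γ) = c⁻¹ • y q γ := lift_y _

/-! ### A basis -/

/-- The scalars in `x y^i = q^{-i} y^i x - γ c_i y^{i-1}`. -/
def leftCoeff (q : k) : ℕ → k
  | 0 => 0
  | i + 1 => q⁻¹ * (leftCoeff q i + 1)

/-- Left multiplication by `y` in terms of the basis `y^i x^j`. -/
noncomputable def actY : Module.End k (ℕ × ℕ →₀ k) :=
  Finsupp.linearCombination k fun p => Finsupp.single (p.1 + 1, p.2) 1

/-- Left multiplication by `x` in terms of the basis `y^i x^j`. -/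
noncomputable def actX (q γ : k) : Module.End k (ℕ × ℕ →₀ k) :=
  Finsupp.linearCombination k fun p =>
    (q⁻¹ ^ p.1) • Finsupp.single (p.1, p.2 + 1) 1 -
      (γ * leftCoeff q p.1) • Finsupp.single (p.1 - 1, p.2) 1

theorem actY_single (i j : ℕ) :
    actY (k := k) (Finsupp.single (i, j) 1) = Finsupp.single (i + 1, j) 1 := by
  simp [actY]

theorem actX_single (i j : ℕ) :
    actX q γ (Finsupp.single (i, j) 1) = (q⁻¹ ^ i) • Finsupp.single (i, j + 1) 1 -
      (γ * leftCoeff q i) • Finsupp.single (i - 1, j) 1 := by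
  rw [actX, Finsupp.linearCombination_single, one_smul]

theorem actY_mul_actX (hq : q ≠ 0) :
    actY * actX q γ = q • (actX q γ * actY) + algebraMap k _ γ := by
  refine Finsupp.basisSingleOne.ext fun p => ?_
  obtain ⟨i, j⟩ := p
  simp only [Finsupp.coe_basisSingleOne, Module.End.mul_apply, LinearMap.add_apply,
    LinearMap.smul_apply, actX_single, actY_single, map_sub, map_smul,
    Module.algebraMap_end_apply, leftCoeff]
  have h1 : q * q⁻¹ ^ (i + 1) = q⁻¹ ^ i := by
    rw [pow_succ', ← mul_assoc, mul_inv_cancel₀ hq, one_mul]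
  rw [smul_sub, smul_smul, h1, smul_smul, Nat.add_sub_cancel,
    show q * (γ * (q⁻¹ * (leftCoeff q i + 1))) = γ * (leftCoeff q i + 1) by field_simp]
  -- For `i = 0` the truncated index `i - 1` is harmless, since `leftCoeff q 0 = 0`.
  cases i with
  | zero => simp [leftCoeff]
  | succ i =>
    rw [Nat.add_sub_cancel]
    module

/-- The left regular representation in terms of the basis `y^i x^j`. -/
noncomputable def regularRep (γ : k) (hq : q ≠ 0) :
    QWeyl q γ →ₐ[k] Module.End k (ℕ × ℕ →₀ k) :=
  lift (C := Module.End k (ℕ × ℕ →₀ k)) _ _ (actY_mul_actX hq)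

theorem regularRep_apply (hq : q ≠ 0) (i j : ℕ) :
    regularRep γ hq (y q γ ^ i * x q γ ^ j) (Finsupp.single (0, 0) 1) =
      Finsupp.single (i, j) 1 := by
  have hx : ∀ j, (actX q γ ^ j) (Finsupp.single (0, 0) 1) = Finsupp.single (0, j) 1 := by
    intro j
    induction j with
    | zero => simp
    | succ j ih => rw [pow_succ', Module.End.mul_apply, ih, actX_single]; simp [leftCoeff]
  have hy : ∀ i, ((actY (k := k)) ^ i) (Finsupp.single (0, j) 1) = Finsupp.single (i, j) 1 := by
    intro i
    induction i with
    | zero => simp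
    | succ i ih => rw [pow_succ', Module.End.mul_apply, ih, actY_single]
  rw [map_mul, map_pow, map_pow, regularRep, lift_x, lift_y, Module.End.mul_apply, hx, hy]

/-- Acting on the vacuum vector `single (0, 0) 1`, the monomials give the standard basis vectors. -/
theorem linearIndependent_monomials (hq : q ≠ 0) :
    LinearIndependent k fun p : ℕ × ℕ => y q γ ^ p.1 * x q γ ^ p.2 := by
  refine LinearIndependent.of_comp
    ((LinearMap.applyₗ (Finsupp.single (0, 0) 1)) ∘ₗ (regularRep γ hq).toLinearMap) ?_
  have : (LinearMap.applyₗ (Finsupp.single (0, 0) 1) ∘ₗ (regularRep γ hq).toLinearMap) ∘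
      (fun p : ℕ × ℕ => y q γ ^ p.1 * x q γ ^ p.2) = Finsupp.basisSingleOne := by
    funext p
    simp only [Function.comp_apply, LinearMap.comp_apply, AlgHom.toLinearMap_apply,
      LinearMap.applyₗ_apply_apply, regularRep_apply, Finsupp.coe_basisSingleOne]
  rw [this]
  exact Finsupp.basisSingleOne.linearIndependent

theorem x_mul_y (hq : q ≠ 0) :
    x q γ * y q γ = q⁻¹ • (y q γ * x q γ - algebraMap k _ γ) := by
  rw [y_mul_x, add_sub_cancel_right, smul_smul, inv_mul_cancel₀ hq, one_smul]

theorem span_monomials (hq : q ≠ 0) :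
    Submodule.span k (Set.range fun p : ℕ × ℕ => y q γ ^ p.1 * x q γ ^ p.2) = ⊤ := by
  set R := Submodule.span k (Set.range fun p : ℕ × ℕ => y q γ ^ p.1 * x q γ ^ p.2) with hR
  have hmem : ∀ i j, y q γ ^ i * x q γ ^ j ∈ R := fun i j => Submodule.subset_span ⟨(i, j), rfl⟩
  have hy : ∀ r ∈ R, y q γ * r ∈ R := by
    intro r hr
    have : R ≤ R.comap (LinearMap.mulLeft k (y q γ)) := by
      rw [hR, Submodule.span_le]
      rintro _ ⟨p, rfl⟩
      change y q γ * (y q γ ^ p.1 * x q γ ^ p.2) ∈ R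
      rw [← mul_assoc, ← pow_succ']
      exact hmem _ _
    exact this hr
  have hx : ∀ i j, x q γ * (y q γ ^ i * x q γ ^ j) ∈ R := by
    intro i j
    induction i with
    | zero =>
      rw [pow_zero, one_mul, ← pow_succ']
      simpa using hmem 0 (j + 1)
    | succ i ih =>
      rw [pow_succ', mul_assoc, ← mul_assoc, x_mul_y hq, smul_mul_assoc, sub_mul, mul_assoc,
        ← Algebra.smul_def]
      exact R.smul_mem _ (R.sub_mem (hy _ ih) (R.smul_mem _ (hmem i j)))
  refine Submodule.eq_top_of_adjoin_mul_mem adjoin_eq_top R (by simpa using hmem 0 0) ?_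
  rintro a (rfl | rfl)
  · intro r hr
    have : R ≤ R.comap (LinearMap.mulLeft k (x q γ)) := by
      rw [hR, Submodule.span_le]
      rintro _ ⟨p, rfl⟩
      exact hx _ _
    exact this hr
  · exact hy

/-- The basis `y^i x^j` of the quantum Weyl algebra. -/
noncomputable def basis (γ : k) (hq : q ≠ 0) : Module.Basis (ℕ × ℕ) k (QWeyl q γ) :=
  Module.Basis.mk (linearIndependent_monomials hq) (span_monomials hq).ge

theorem basis_apply (hq : q ≠ 0) (i j : ℕ) : basis γ hq (i, j) = y q γ ^ i * x q γ ^ j := by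
  simp [basis]

/-! ### The Koszul complex -/

section Koszul

open MulOpposite

variable (q γ)

/-- The element `x ⊗ 1 - 1 ⊗ x`. -/
noncomputable def kX : EnvelopingAlgebra k (QWeyl q γ) := x q γ ⊗ₜ 1 - 1 ⊗ₜ op (x q γ)

/-- The element `y ⊗ 1 - 1 ⊗ y`. -/
noncomputable def kY : EnvelopingAlgebra k (QWeyl q γ) := y q γ ⊗ₜ 1 - 1 ⊗ₜ op (y q γ)

/-- The element `1 ⊗ x - q x ⊗ 1`. -/
noncomputable def kX' : EnvelopingAlgebra k (QWeyl q γ) := 1 ⊗ₜ op (x q γ) - q • x q γ ⊗ₜ 1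

/-- The element `y ⊗ 1 - q 1 ⊗ y`. -/
noncomputable def kY' : EnvelopingAlgebra k (QWeyl q γ) := y q γ ⊗ₜ 1 - q • 1 ⊗ₜ op (y q γ)

theorem op_x_mul_op_y :
    op (x q γ) * op (y q γ) = q • (op (y q γ) * op (x q γ)) + algebraMap k _ γ := by
  rw [← MulOpposite.op_mul, y_mul_x]; rfl

theorem kY'_mul_kX_add : kY' q γ * kX q γ + kX' q γ * kY q γ = 0 := by
  simp only [kX, kY, kX', kY', mul_sub, sub_mul, Algebra.TensorProduct.tmul_mul_tmul,
    smul_mul_assoc, mul_one, one_mul, op_x_mul_op_y, y_mul_x, TensorProduct.add_tmul,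
    TensorProduct.tmul_add, ← TensorProduct.smul_tmul', TensorProduct.tmul_smul,
    Algebra.algebraMap_eq_smul_one]
  module

variable {q γ}

theorem mulRight_rTensor {B C : Type*} [Ring B] [Ring C] [Algebra k B] [Algebra k C] (b : B)
    (w : B ⊗[k] C) : (LinearMap.mulRight k b).rTensor C w = w * (b ⊗ₜ 1) := by
  induction w with
  | zero => simp
  | add u v hu hv => rw [map_add, hu, hv, add_mul]
  | tmul u v => simp

theorem mulRight_lTensor {B C : Type*} [Ring B] [Ring C] [Algebra k B] [Algebra k C] (c : C)
    (w : B ⊗[k] C) : (LinearMap.mulRight k c).lTensor B w = w * (1 ⊗ₜ c) := by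
  induction w with
  | zero => simp
  | add u v hu hv => rw [map_add, hu, hv, add_mul]
  | tmul u v => simp

theorem mulLeft_rTensor {B C : Type*} [Ring B] [Ring C] [Algebra k B] [Algebra k C] (b : B)
    (w : B ⊗[k] C) : (LinearMap.mulLeft k b).rTensor C w = (b ⊗ₜ 1) * w := by
  induction w with
  | zero => simp
  | add u v hu hv => rw [map_add, hu, hv, mul_add]
  | tmul u v => simp

theorem mulLeft_lTensor {B C : Type*} [Ring B] [Ring C] [Algebra k B] [Algebra k C] (c : C)
    (w : B ⊗[k] C) : (LinearMap.mulLeft k c).lTensor B w = (1 ⊗ₜ c) * w := by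
  induction w with
  | zero => simp
  | add u v hu hv => rw [map_add, hu, hv, mul_add]
  | tmul u v => simp

theorem mulRight_x_basis (hq : q ≠ 0) (i j : ℕ) :
    LinearMap.mulRight k (x q γ) (basis γ hq (i, j)) = basis γ hq (i, j + 1) := by
  rw [LinearMap.mulRight_apply, basis_apply, basis_apply, mul_assoc, ← pow_succ]

theorem mulLeft_y_basis (hq : q ≠ 0) (i j : ℕ) :
    LinearMap.mulLeft k (y q γ) ((basis γ hq).reindex (Equiv.prodComm ℕ ℕ) (i, j)) =
      (basis γ hq).reindex (Equiv.prodComm ℕ ℕ) (i, j + 1) := by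
  simp only [Module.Basis.reindex_apply, Equiv.prodComm_symm, Equiv.prodComm_apply, Prod.swap]
  rw [LinearMap.mulLeft_apply, basis_apply, basis_apply, ← mul_assoc, ← pow_succ']

/-- In the basis `y ^ i x ^ j`, right multiplication by `x` raises `j`, and right multiplication by
`y` raises `i` when `j = 0`: the setting of `exists_of_qKoszul`. -/
theorem koszul_exact_left (hq : q ≠ 0) (u v : EnvelopingAlgebra k (QWeyl q γ))
    (h : u * kX q γ + v * kY q γ = 0) : ∃ w, u = w * kY' q γ ∧ v = w * kX' q γ := by
  have := exists_of_qKoszul (basis γ hq) (ξ := LinearMap.mulRight k (x q γ))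
    (η := LinearMap.mulRight k (y q γ)) (mulRight_x_basis hq)
    (fun i => by
      rw [LinearMap.mulRight_apply, basis_apply, basis_apply, pow_zero, mul_one, mul_one, pow_succ])
    (LinearMap.mulRight k (op (x q γ))) (LinearMap.mulRight k (op (y q γ))) (γ := γ) hq
    (fun u => by
      simp only [LinearMap.mulRight_apply]
      rw [mul_assoc, y_mul_x, mul_add, mul_smul_comm, mul_assoc, ← Algebra.commutes,
        Algebra.smul_def γ])
    (fun v => by
      simp only [LinearMap.mulRight_apply]
      rw [mul_assoc, op_x_mul_op_y, mul_add, mul_smul_comm, mul_assoc, ← Algebra.commutes,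
        Algebra.smul_def γ])
    (u := u) (v := v) (by
      simpa only [mulRight_rTensor, mulRight_lTensor, kX, kY, mul_sub] using h)
  simpa only [mulRight_rTensor, mulRight_lTensor, kX', kY', mul_sub, mul_smul_comm] using this

theorem koszul_injective_left (hq : q ≠ 0) (w : EnvelopingAlgebra k (QWeyl q γ))
    (h : w * kX' q γ = 0) : w = 0 := by
  refine eq_zero_of_lTensor_sub_smul_rTensor (basis γ hq) (ξ := LinearMap.mulRight k (x q γ))
    (mulRight_x_basis hq) (LinearMap.mulRight k (op (x q γ))) hq ?_
  simpa only [mulRight_rTensor, mulRight_lTensor, kX', mul_sub, mul_smul_comm] using h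

theorem koszul_exact_right (hq : q ≠ 0) (p r : EnvelopingAlgebra k (QWeyl q γ))
    (h : kY' q γ * p + kX' q γ * r = 0) : ∃ w, p = kX q γ * w ∧ r = kY q γ * w := by
  obtain ⟨w, hp, hr⟩ := exists_of_qKoszul ((basis γ hq).reindex (Equiv.prodComm ℕ ℕ))
    -- For left multiplication the roles of `x` and `y` are exchanged. The scalars on `ξ'`, `η'` and
    -- the choice `v = -q r` come from `kX' = -q (x ⊗ 1 - q⁻¹ 1 ⊗ op x)`.
    (ξ := LinearMap.mulLeft k (y q γ)) (η := LinearMap.mulLeft k (x q γ)) (mulLeft_y_basis hq)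
    (fun i => by
      simp only [Module.Basis.reindex_apply, Equiv.prodComm_symm, Equiv.prodComm_apply, Prod.swap]
      rw [LinearMap.mulLeft_apply, basis_apply, basis_apply, pow_zero, one_mul, one_mul, pow_succ'])
    (q • LinearMap.mulLeft k (op (y q γ))) (q⁻¹ • LinearMap.mulLeft k (op (x q γ))) (γ := γ) hq
    (fun u => by
      simp only [LinearMap.mulLeft_apply]
      rw [← mul_assoc, y_mul_x, add_mul, smul_mul_assoc, mul_assoc, Algebra.smul_def γ])
    (fun v => by
      simp only [LinearMap.mulLeft_apply, LinearMap.smul_apply, mul_smul_comm, smul_smul,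
        inv_mul_cancel₀ hq, mul_inv_cancel₀ hq, one_smul, ← mul_assoc, op_x_mul_op_y]
      rw [add_mul, smul_mul_assoc, Algebra.smul_def γ])
    (u := p) (v := -(q • r)) (by
      rw [← h]
      simp only [mulLeft_rTensor, LinearMap.lTensor_smul, LinearMap.smul_apply, mulLeft_lTensor,
        kX', kY', sub_mul, smul_mul_assoc, mul_neg, mul_smul_comm, smul_neg, smul_smul,
        inv_mul_cancel₀ hq, one_smul]
      module)
  simp only [mulLeft_rTensor, LinearMap.lTensor_smul, LinearMap.smul_apply, mulLeft_lTensor,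
    smul_smul, mul_inv_cancel₀ hq, one_smul] at hp hr
  refine ⟨w, by rw [hp, kX, sub_mul], ?_⟩
  have := congrArg (fun t => -(q⁻¹ • t)) hr
  simp only [smul_neg, neg_neg, smul_sub, smul_smul, inv_mul_cancel₀ hq, one_smul] at this
  rw [this, kY, sub_mul, neg_sub]

theorem koszul_injective_right (hq : q ≠ 0) (w : EnvelopingAlgebra k (QWeyl q γ))
    (h : kY q γ * w = 0) : w = 0 := by
  refine eq_zero_of_rTensor_sub_lTensor ((basis γ hq).reindex (Equiv.prodComm ℕ ℕ))
    (ξ := LinearMap.mulLeft k (y q γ)) (mulLeft_y_basis hq)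
    (LinearMap.mulLeft k (op (y q γ))) fun i j => ?_
  rw [kY, sub_mul] at h
  rw [mulLeft_rTensor, mulLeft_lTensor, h, map_zero]

/-- The multiplication `b ⊗ c ↦ b c`. -/
noncomputable def kε (B : Type*) [Ring B] [Algebra k B] : EnvelopingAlgebra k B →ₗ[k] B :=
  TensorProduct.lift
    ((LinearMap.mul k B).compl₂ (opLinearEquiv k).symm.toLinearMap)

theorem kε_tmul {B : Type*} [Ring B] [Algebra k B] (b c : B) :
    kε (k := k) B (b ⊗ₜ op c) = b * c := rfl

theorem kε_mul {B : Type*} [Ring B] [Algebra k B] (b c : B) (w : EnvelopingAlgebra k B) :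
    kε (k := k) B ((b ⊗ₜ op c) * w) = b * kε (k := k) B w * c := by
  induction w using TensorProduct.induction_on with
  | zero => simp
  | add u v hu hv => rw [mul_add, map_add, hu, hv, map_add, mul_add, add_mul]
  | tmul u v =>
    obtain ⟨v, rfl⟩ := op_surjective v
    rw [Algebra.TensorProduct.tmul_mul_tmul, ← MulOpposite.op_mul, kε_tmul, kε_tmul]
    simp only [mul_assoc]

/-- The twisted multiplication `b ⊗ c ↦ c ν(b)`. -/
noncomputable def kψ {B : Type*} [Ring B] [Algebra k B] (ν : B →ₐ[k] B) :
    EnvelopingAlgebra k B →ₗ[k] B :=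
  TensorProduct.lift
    (((LinearMap.mul k B).flip.comp ν.toLinearMap).compl₂ (opLinearEquiv k).symm.toLinearMap)

theorem kψ_tmul {B : Type*} [Ring B] [Algebra k B] (ν : B →ₐ[k] B) (b c : B) :
    kψ ν (b ⊗ₜ op c) = c * ν b := rfl

theorem kψ_mul {B : Type*} [Ring B] [Algebra k B] (ν : B →ₐ[k] B) (b c : B)
    (w : EnvelopingAlgebra k B) : kψ ν (w * (b ⊗ₜ op c)) = c * kψ ν w * ν b := by
  induction w using TensorProduct.induction_on with
  | zero => simp
  | add u v hu hv => rw [add_mul, map_add, hu, hv, map_add, mul_add, add_mul]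
  | tmul u v =>
    obtain ⟨v, rfl⟩ := op_surjective v
    rw [Algebra.TensorProduct.tmul_mul_tmul, ← MulOpposite.op_mul, kψ_tmul, kψ_tmul, map_mul]
    simp only [mul_assoc]

/-- The kernel of multiplication is the left ideal generated by all `b ⊗ 1 - 1 ⊗ op b`. This
expression obeys a Leibniz rule in `b`, so the algebra generators `x`, `y` suffice. -/
theorem kε_eq_zero_iff (z : EnvelopingAlgebra k (QWeyl q γ)) :
    kε (k := k) _ z = 0 ↔ ∃ u v, z = u * kX q γ + v * kY q γ := by
  constructor
  · let J : Submodule k (EnvelopingAlgebra k (QWeyl q γ)) :=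
      LinearMap.range (LinearMap.mulRight k (kX q γ)) ⊔
        LinearMap.range (LinearMap.mulRight k (kY q γ))
    have hJ : ∀ w, ∀ j ∈ J, w * j ∈ J := by
      intro w j hj
      obtain ⟨_, ⟨u, rfl⟩, _, ⟨v, rfl⟩, rfl⟩ := Submodule.mem_sup.1 hj
      rw [mul_add, LinearMap.mulRight_apply, LinearMap.mulRight_apply, ← mul_assoc, ← mul_assoc]
      exact J.add_mem (Submodule.mem_sup_left ⟨_, rfl⟩) (Submodule.mem_sup_right ⟨_, rfl⟩)
    have key : ∀ b : QWeyl q γ,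
        (b ⊗ₜ[k] (1 : (QWeyl q γ)ᵐᵒᵖ) - 1 ⊗ₜ op b : EnvelopingAlgebra k (QWeyl q γ)) ∈ J := by
      intro b
      have hb : b ∈ Algebra.adjoin k {x q γ, y q γ} := by
        rw [adjoin_eq_top]
        exact Algebra.mem_top
      induction hb using Algebra.adjoin_induction with
      | mem a ha =>
        obtain rfl | rfl := ha
        · exact Submodule.mem_sup_left ⟨1, one_mul _⟩
        · exact Submodule.mem_sup_right ⟨1, one_mul _⟩
      | algebraMap t =>
        rw [Algebra.algebraMap_eq_smul_one, MulOpposite.op_smul, TensorProduct.tmul_smul,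
          ← TensorProduct.smul_tmul', MulOpposite.op_one, sub_self]
        exact J.zero_mem
      | add a b _ _ ha hb =>
        rw [MulOpposite.op_add, TensorProduct.add_tmul, TensorProduct.tmul_add, add_sub_add_comm]
        exact J.add_mem ha hb
      | mul a b _ _ ha hb =>
        have := J.add_mem (hJ (a ⊗ₜ 1) _ hb) (hJ (1 ⊗ₜ op b) _ ha)
        simpa [mul_sub, Algebra.TensorProduct.tmul_mul_tmul] using this
    have key' : ∀ z, z - 1 ⊗ₜ op (kε (k := k) _ z) ∈ J := by
      intro z
      induction z using TensorProduct.induction_on with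
      | zero => simp
      | add u v hu hv =>
        rw [map_add, MulOpposite.op_add, TensorProduct.tmul_add, add_sub_add_comm]
        exact J.add_mem hu hv
      | tmul u v =>
        obtain ⟨v, rfl⟩ := op_surjective v
        have := hJ (1 ⊗ₜ op v) _ (key u)
        simpa [mul_sub, Algebra.TensorProduct.tmul_mul_tmul, kε_tmul] using this
    intro h
    have := key' z
    rw [h, MulOpposite.op_zero, TensorProduct.tmul_zero, sub_zero] at this
    obtain ⟨_, ⟨u, rfl⟩, _, ⟨v, rfl⟩, h⟩ := Submodule.mem_sup.1 this
    exact ⟨u, v, h.symm⟩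
  · have key : ∀ w X : EnvelopingAlgebra k (QWeyl q γ), kε (k := k) _ X = 0 → kε (k := k) _ (w * X) = 0 := by
      intro w X hX
      induction w using TensorProduct.induction_on with
      | zero => simp
      | add u v hu hv => rw [add_mul, map_add, hu, hv, add_zero]
      | tmul u v =>
        obtain ⟨v, rfl⟩ := op_surjective v
        rw [kε_mul, hX, mul_zero, zero_mul]
    rintro ⟨u, v, rfl⟩
    rw [map_add, key _ _ ?_, key _ _ ?_, add_zero]
    · rw [kY, map_sub, kε_tmul, ← MulOpposite.op_one, kε_tmul, mul_one, one_mul, sub_self]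
    · rw [kX, map_sub, kε_tmul, ← MulOpposite.op_one, kε_tmul, mul_one, one_mul, sub_self]

/-- Modulo the right ideal generated by `kY'` and `kX'` one has `b ⊗ 1 ≡ 1 ⊗ op (ν b)`, first on
`x`, `y` and then by a twisted Leibniz rule. This is where the twist of the dualizing bimodule
arises. -/
theorem kψ_eq_zero_iff (hq : q ≠ 0) (z : EnvelopingAlgebra k (QWeyl q γ)) :
    kψ (scale (inv_ne_zero hq)) z = 0 ↔ ∃ p r, z = kY' q γ * p + kX' q γ * r := by
  set ν : QWeyl q γ →ₐ[k] QWeyl q γ := scale (inv_ne_zero hq) with hν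
  have hνx : ν (x q γ) = q⁻¹ • x q γ := scale_x _
  have hνy : ν (y q γ) = q • y q γ := by rw [hν, scale_y, inv_inv]
  constructor
  · let J : Submodule k (EnvelopingAlgebra k (QWeyl q γ)) :=
      LinearMap.range (LinearMap.mulLeft k (kY' q γ)) ⊔
        LinearMap.range (LinearMap.mulLeft k (kX' q γ))
    have hJ : ∀ w, ∀ j ∈ J, j * w ∈ J := by
      intro w j hj
      obtain ⟨_, ⟨u, rfl⟩, _, ⟨v, rfl⟩, rfl⟩ := Submodule.mem_sup.1 hj
      rw [add_mul, LinearMap.mulLeft_apply, LinearMap.mulLeft_apply, mul_assoc, mul_assoc]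
      exact J.add_mem (Submodule.mem_sup_left ⟨_, rfl⟩) (Submodule.mem_sup_right ⟨_, rfl⟩)
    have key : ∀ b : QWeyl q γ,
        (b ⊗ₜ[k] (1 : (QWeyl q γ)ᵐᵒᵖ) - 1 ⊗ₜ op (ν b) : EnvelopingAlgebra k (QWeyl q γ)) ∈ J := by
      intro b
      have hb : b ∈ Algebra.adjoin k {x q γ, y q γ} := by
        rw [adjoin_eq_top]
        exact Algebra.mem_top
      induction hb using Algebra.adjoin_induction with
      | mem a ha =>
        obtain rfl | rfl := ha
        · refine Submodule.mem_sup_right ⟨-q⁻¹ • 1, ?_⟩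
          rw [LinearMap.mulLeft_apply, mul_smul_comm, mul_one, kX', smul_sub, smul_smul, hνx,
            MulOpposite.op_smul, TensorProduct.tmul_smul, neg_mul, inv_mul_cancel₀ hq]
          module
        · refine Submodule.mem_sup_left ⟨1, ?_⟩
          rw [LinearMap.mulLeft_apply, mul_one, hνy, kY', MulOpposite.op_smul, TensorProduct.tmul_smul]
      | algebraMap t =>
        rw [Algebra.algebraMap_eq_smul_one, map_smul, map_one, MulOpposite.op_smul, TensorProduct.tmul_smul,
          ← TensorProduct.smul_tmul', MulOpposite.op_one, sub_self]
        exact J.zero_mem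
      | add a b _ _ ha hb =>
        rw [map_add, MulOpposite.op_add, TensorProduct.add_tmul, TensorProduct.tmul_add, add_sub_add_comm]
        exact J.add_mem ha hb
      | mul a b _ _ ha hb =>
        have := J.add_mem (hJ (b ⊗ₜ 1) _ ha) (hJ (1 ⊗ₜ op (ν a)) _ hb)
        simpa [sub_mul, Algebra.TensorProduct.tmul_mul_tmul] using this
    have key' : ∀ z, z - 1 ⊗ₜ op (kψ ν z) ∈ J := by
      intro z
      induction z using TensorProduct.induction_on with
      | zero => simp
      | add u v hu hv =>
        rw [map_add, MulOpposite.op_add, TensorProduct.tmul_add, add_sub_add_comm]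
        exact J.add_mem hu hv
      | tmul u v =>
        obtain ⟨v, rfl⟩ := op_surjective v
        have := hJ (1 ⊗ₜ op v) _ (key u)
        simpa [sub_mul, Algebra.TensorProduct.tmul_mul_tmul, kψ_tmul] using this
    intro h
    have := key' z
    rw [h, MulOpposite.op_zero, TensorProduct.tmul_zero, sub_zero] at this
    obtain ⟨_, ⟨u, rfl⟩, _, ⟨v, rfl⟩, h⟩ := Submodule.mem_sup.1 this
    exact ⟨u, v, h.symm⟩
  · have key : ∀ w X : EnvelopingAlgebra k (QWeyl q γ), kψ ν X = 0 → kψ ν (X * w) = 0 := by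
      intro w X hX
      induction w using TensorProduct.induction_on with
      | zero => simp
      | add u v hu hv => rw [mul_add, map_add, hu, hv, add_zero]
      | tmul u v =>
        obtain ⟨v, rfl⟩ := op_surjective v
        rw [kψ_mul, hX, mul_zero, zero_mul]
    rintro ⟨u, v, rfl⟩
    rw [map_add, key _ _ ?_, key _ _ ?_, add_zero]
    · rw [kX', map_sub, map_smul, kψ_tmul, ← MulOpposite.op_one, kψ_tmul, map_one, mul_one, one_mul, hνx,
        smul_smul, mul_inv_cancel₀ hq, one_smul, sub_self]
    · rw [kY', map_sub, map_smul, kψ_tmul, ← MulOpposite.op_one, kψ_tmul, map_one, mul_one, one_mul, hνy,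
        sub_self]

end Koszul

end QWeyl

/-! ### Averaging over a cyclic group, and dual bases for a strong grading. -/

section CyclicAverage

variable {k B : Type*} [Field k] [Ring B] [Algebra k B]

/-- The average of the powers of `θ`. -/
noncomputable def cyclicAverage (N : ℕ) (θ : B →ₐ[k] B) : B →ₗ[k] B :=
  (N : k)⁻¹ • ∑ j ∈ Finset.range N, (θ ^ j).toLinearMap

variable {N : ℕ} {θ : B →ₐ[k] B}

theorem cyclicAverage_apply (b : B) :
    cyclicAverage N θ b = (N : k)⁻¹ • ∑ j ∈ Finset.range N, (θ ^ j) b := by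
  simp [cyclicAverage, LinearMap.sum_apply]

theorem AlgHom.pow_apply_of_eigen {c : k} {b : B} (h : θ b = c • b) (j : ℕ) :
    (θ ^ j) b = c ^ j • b := by
  induction j with
  | zero => simp
  | succ j ih => rw [pow_succ', AlgHom.mul_apply, ih, map_smul, h, smul_smul, pow_succ]

theorem cyclicAverage_of_eigen (hN : (N : k) ≠ 0) {c : k} (hc : c ^ N = 1) {b : B}
    (h : θ b = c • b) [Decidable (c = 1)] :
    cyclicAverage N θ b = if c = 1 then b else 0 := by
  rw [cyclicAverage_apply]
  simp_rw [AlgHom.pow_apply_of_eigen h]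
  rw [← Finset.sum_smul, smul_smul]
  split_ifs with h1
  · simp [h1, inv_mul_cancel₀ hN]
  · have : (∑ j ∈ Finset.range N, c ^ j) * (c - 1) = 0 := by rw [geom_sum_mul, hc, sub_self]
    rw [(mul_eq_zero.1 this).resolve_right (sub_ne_zero.2 h1), mul_zero, zero_smul]

theorem cyclicAverage_mul_of_fixed (b : B) {c : B} (hc : θ c = c) :
    cyclicAverage N θ (b * c) = cyclicAverage N θ b * c := by
  have h : ∀ j, (θ ^ j) c = c := fun j => by
    simpa using AlgHom.pow_apply_of_eigen (θ := θ) (c := (1 : k)) (b := c) (by simpa using hc) j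
  simp_rw [cyclicAverage_apply, map_mul, h]
  rw [← Finset.sum_mul, smul_mul_assoc]

theorem cyclicAverage_fixed_mul (b : B) {c : B} (hc : θ c = c) :
    cyclicAverage N θ (c * b) = c * cyclicAverage N θ b := by
  have h : ∀ j, (θ ^ j) c = c := fun j => by
    simpa using AlgHom.pow_apply_of_eigen (θ := θ) (c := (1 : k)) (b := c) (by simpa using hc) j
  simp_rw [cyclicAverage_apply, map_mul, h]
  rw [← Finset.mul_sum, mul_smul_comm]

theorem cyclicAverage_map (hθ : θ ^ N = 1) (b : B) :
    cyclicAverage N θ (θ b) = cyclicAverage N θ b := by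
  rw [cyclicAverage_apply, cyclicAverage_apply]
  congr 1
  have h1 := Finset.sum_range_succ (fun j => (θ ^ j) b) N
  rw [Finset.sum_range_succ', hθ] at h1
  simpa [pow_succ] using h1

variable (hN : (N : k) ≠ 0) {ζ : k} (hζ : IsPrimitiveRoot ζ N)
  (hspan : Submodule.span k {b : B | ∃ c : k, c ^ N = 1 ∧ θ b = c • b} = ⊤)
  {ι : Type*} [Fintype ι] {u v : Fin N → ι → B}
  (hu : ∀ g i, θ (u g i) = (ζ ^ (g : ℕ))⁻¹ • u g i) (hv : ∀ g i, θ (v g i) = ζ ^ (g : ℕ) • v g i)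
  (huv : ∀ g, ∑ i, u g i * v g i = 1)

include hN hζ hspan hu huv in
-- On an eigenvector `x`, averaging kills `x * u g i` unless `g` is the degree of `x`; the surviving
-- terms are `x * ∑ u g i * v g i = x`.
theorem sum_cyclicAverage_mul (b : B) :
    ∑ p : Fin N × ι, cyclicAverage N θ (b * u p.1 p.2) * v p.1 p.2 = b := by
  classical
  have : NeZero N := ⟨fun h => hN (by simp [h])⟩
  have hb : b ∈ Submodule.span k {b : B | ∃ c : k, c ^ N = 1 ∧ θ b = c • b} := hspan ▸ trivial
  induction hb using Submodule.span_induction with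
  | zero => simp
  | add x y _ _ hx hy =>
    simp_rw [add_mul, map_add, add_mul]
    rw [Finset.sum_add_distrib, hx, hy]
  | smul t x _ hx =>
    simp_rw [smul_mul_assoc, map_smul, smul_mul_assoc]
    rw [← Finset.smul_sum, hx]
  | mem x hx =>
    obtain ⟨c, hc, hx⟩ := hx
    obtain ⟨g', hg', rfl⟩ := hζ.eq_pow_of_pow_eq_one hc
    have key : ∀ g i, cyclicAverage N θ (x * u g i) * v g i =
        if g = ⟨g', hg'⟩ then x * (u g i * v g i) else 0 := by
      intro g i
      rw [cyclicAverage_of_eigen hN (c := ζ ^ g' * (ζ ^ (g : ℕ))⁻¹)]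
      · have : ζ ^ g' * (ζ ^ (g : ℕ))⁻¹ = 1 ↔ g = ⟨g', hg'⟩ := by
          rw [mul_inv_eq_one₀ (pow_ne_zero _ (hζ.ne_zero (NeZero.ne N))), Fin.ext_iff]
          exact ⟨fun h => (hζ.pow_inj hg' g.2 h).symm, fun h => by rw [h]⟩
        simp_rw [this]
        split_ifs
        · rw [mul_assoc]
        · rw [zero_mul]
      · rw [mul_pow, hc, inv_pow, pow_right_comm, hζ.pow_eq_one, one_pow, inv_one, one_mul]
      · rw [map_mul, hx, hu, smul_mul_smul_comm]
    rw [Fintype.sum_prod_type]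
    simp_rw [key]
    rw [Finset.sum_comm]
    simp only [Finset.sum_ite_eq', Finset.mem_univ, if_true]
    rw [← Finset.mul_sum, huv, mul_one]

include hN hζ hspan hv huv in
theorem sum_mul_cyclicAverage (b : B) :
    ∑ p : Fin N × ι, u p.1 p.2 * cyclicAverage N θ (v p.1 p.2 * b) = b := by
  classical
  have : NeZero N := ⟨fun h => hN (by simp [h])⟩
  have hb : b ∈ Submodule.span k {b : B | ∃ c : k, c ^ N = 1 ∧ θ b = c • b} := hspan ▸ trivial
  induction hb using Submodule.span_induction with
  | zero => simp
  | add x y _ _ hx hy =>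
    simp_rw [mul_add, map_add, mul_add]
    rw [Finset.sum_add_distrib, hx, hy]
  | smul t x _ hx =>
    simp_rw [mul_smul_comm, map_smul, mul_smul_comm]
    rw [← Finset.smul_sum, hx]
  | mem x hx =>
    obtain ⟨c, hc, hx⟩ := hx
    obtain ⟨g', hg', hcg⟩ := hζ.eq_pow_of_pow_eq_one (ξ := c⁻¹) (by rw [inv_pow, hc, inv_one])
    have hc0 : c ≠ 0 := fun h => by simp [h, NeZero.ne N] at hc
    have key : ∀ g i, u g i * cyclicAverage N θ (v g i * x) =
        if g = ⟨g', hg'⟩ then u g i * v g i * x else 0 := by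
      intro g i
      rw [cyclicAverage_of_eigen hN (c := ζ ^ (g : ℕ) * c)]
      · have : ζ ^ (g : ℕ) * c = 1 ↔ g = ⟨g', hg'⟩ := by
          rw [mul_eq_one_iff_eq_inv₀ hc0, ← hcg, Fin.ext_iff]
          exact ⟨fun h => hζ.pow_inj g.2 hg' h, fun h => by rw [h]⟩
        simp_rw [this]
        split_ifs
        · rw [mul_assoc]
        · rw [mul_zero]
      · rw [mul_pow, hc, pow_right_comm, hζ.pow_eq_one, one_pow, mul_one]
      · rw [map_mul, hx, hv, smul_mul_smul_comm]
    rw [Fintype.sum_prod_type]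
    simp_rw [key]
    rw [Finset.sum_comm]
    simp only [Finset.sum_ite_eq', Finset.mem_univ, if_true]
    rw [← Finset.sum_mul, huv, one_mul]

end CyclicAverage

/-! ### Passage to enveloping algebras. -/

section Enveloping

open MulOpposite

/-- An extension `φ : A → B` with a trace `p`, dual bases, and an automorphism `θ` of finite
order. -/
structure CyclicTraceExtension (k : Type*) (A B : Type*) [Field k] [Ring A] [Ring B]
    [Algebra k A] [Algebra k B] where
  /-- The structure map. -/
  φ : A →ₐ[k] B
  /-- The trace. -/
  p : B →ₗ[k] A
  p_mul_left : ∀ a b, p (φ a * b) = a * p b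
  p_mul_right : ∀ a b, p (b * φ a) = p b * a
  /-- The index set of the dual bases. -/
  ix : Type
  [fintype_ix : Fintype ix]
  /-- The first of the dual bases. -/
  u : ix → B
  /-- The second of the dual bases. -/
  v : ix → B
  left_dual : ∀ b, ∑ i, φ (p (b * u i)) * v i = b
  right_dual : ∀ b, ∑ i, u i * φ (p (v i * b)) = b
  /-- The order of the automorphism. -/
  N : ℕ
  N_ne_zero : (N : k) ≠ 0
  /-- The automorphism. -/
  θ : B →ₐ[k] B
  θ_pow : θ ^ N = 1
  θ_φ : ∀ a, θ (φ a) = φ a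
  p_θ : ∀ b, p (θ b) = p b

attribute [instance] CyclicTraceExtension.fintype_ix

variable {k : Type*} [Field k]

/-- The map of enveloping algebras induced by an algebra map. -/
noncomputable def envelopingMap {A B : Type*} [Ring A] [Ring B] [Algebra k A] [Algebra k B]
    (f : A →ₐ[k] B) : EnvelopingAlgebra k A →ₐ[k] EnvelopingAlgebra k B :=
  Algebra.TensorProduct.map f (AlgHom.op f)

theorem envelopingMap_tmul {A B : Type*} [Ring A] [Ring B] [Algebra k A] [Algebra k B]
    (f : A →ₐ[k] B) (a c : A) :
    envelopingMap f (a ⊗ₜ op c) = f a ⊗ₜ op (f c) := rfl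

theorem EnvelopingAlgebra.induction_on {A : Type*} [Ring A] [Algebra k A]
    {motive : EnvelopingAlgebra k A → Prop} (z : EnvelopingAlgebra k A)
    (tmul : ∀ a c : A, motive (a ⊗ₜ op c)) (add : ∀ x y, motive x → motive y → motive (x + y)) :
    motive z := by
  induction z using TensorProduct.induction_on with
  | zero => simpa using tmul 0 0
  | add x y hx hy => exact add x y hx hy
  | tmul a c => exact tmul a c.unop

theorem tmul_op_mul_tmul_op {A : Type*} [Ring A] [Algebra k A] (a b c d : A) :
    ((a ⊗ₜ op b) * (c ⊗ₜ op d) : EnvelopingAlgebra k A) = (a * c) ⊗ₜ op (d * b) :=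
  Algebra.TensorProduct.tmul_mul_tmul ..

namespace CyclicTraceExtension

variable {A B : Type*} [Ring A] [Ring B] [Algebra k A] [Algebra k B]
  (T : CyclicTraceExtension k A B)

/-- The trace on enveloping algebras. -/
noncomputable def envelopingTrace : EnvelopingAlgebra k B →ₗ[k] EnvelopingAlgebra k A :=
  TensorProduct.map T.p
    ((opLinearEquiv k).toLinearMap ∘ₗ T.p ∘ₗ (opLinearEquiv k).symm.toLinearMap)

theorem envelopingTrace_tmul (b c : B) :
    T.envelopingTrace (b ⊗ₜ op c) = T.p b ⊗ₜ op (T.p c) := rfl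

/-- The enveloping algebra of `B` as a module over the enveloping algebra of `A`. -/
@[reducible]
noncomputable def envelopingModule : Module (EnvelopingAlgebra k A) (EnvelopingAlgebra k B) :=
  Module.compHom _ (envelopingMap T.φ).toRingHom

end CyclicTraceExtension

variable {A B : Type v} [Ring A] [Ring B] [Algebra k A] [Algebra k B]
  (T : CyclicTraceExtension k A B)

theorem CyclicTraceExtension.op_sum {ι : Type*} (s : Finset ι) (f : ι → B) :
    op (∑ i ∈ s, f i) = ∑ i ∈ s, op (f i) := map_sum (opAddEquiv : B ≃+ Bᵐᵒᵖ) f s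

/-- The Frobenius extension of enveloping algebras. -/
noncomputable def CyclicTraceExtension.enveloping :
    letI := T.envelopingModule
    CyclicFrobeniusExtension k (EnvelopingAlgebra k A) (EnvelopingAlgebra k B) :=
  letI := T.envelopingModule
  { ι := envelopingMap T.φ
    smul_eq := fun s e => rfl
    π := T.envelopingTrace
    π_mul_left := fun s e => by
      induction s using EnvelopingAlgebra.induction_on with
      | add x y hx hy => rw [map_add, add_mul, map_add, hx, hy, add_mul]
      | tmul a c =>
        induction e using EnvelopingAlgebra.induction_on with
        | add x y hx hy => rw [mul_add, map_add, hx, hy, map_add, mul_add]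
        | tmul b d =>
          rw [envelopingMap_tmul, tmul_op_mul_tmul_op, envelopingTrace_tmul, envelopingTrace_tmul,
            tmul_op_mul_tmul_op, T.p_mul_left, T.p_mul_right]
    π_mul_right := fun s e => by
      induction s using EnvelopingAlgebra.induction_on with
      | add x y hx hy => rw [map_add, mul_add, map_add, hx, hy, mul_add]
      | tmul a c =>
        induction e using EnvelopingAlgebra.induction_on with
        | add x y hx hy => rw [add_mul, map_add, hx, hy, map_add, add_mul]
        | tmul b d =>
          rw [envelopingMap_tmul, tmul_op_mul_tmul_op, envelopingTrace_tmul, envelopingTrace_tmul,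
            tmul_op_mul_tmul_op, T.p_mul_left, T.p_mul_right]
    ix := T.ix × T.ix
    -- The dual bases change places in the opposite factor, where multiplication is reversed.
    u := fun i => T.u i.1 ⊗ₜ op (T.v i.2)
    v := fun i => T.v i.1 ⊗ₜ op (T.u i.2)
    left_dual := fun e => by
      induction e using EnvelopingAlgebra.induction_on with
      | add x y hx hy =>
        simp_rw [add_mul, map_add, add_mul]
        rw [Finset.sum_add_distrib, hx, hy]
      | tmul b c =>
        simp_rw [tmul_op_mul_tmul_op, envelopingTrace_tmul, envelopingMap_tmul,
          tmul_op_mul_tmul_op]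
        rw [Fintype.sum_prod_type]
        simp_rw [← TensorProduct.tmul_sum, ← op_sum, T.right_dual]
        rw [← TensorProduct.sum_tmul, T.left_dual]
    right_dual := fun e => by
      induction e using EnvelopingAlgebra.induction_on with
      | add x y hx hy =>
        simp_rw [mul_add, map_add, mul_add]
        rw [Finset.sum_add_distrib, hx, hy]
      | tmul b c =>
        simp_rw [tmul_op_mul_tmul_op, envelopingTrace_tmul, envelopingMap_tmul,
          tmul_op_mul_tmul_op]
        rw [Fintype.sum_prod_type]
        simp_rw [← TensorProduct.tmul_sum, ← op_sum, T.left_dual]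
        rw [← TensorProduct.sum_tmul, T.right_dual]
    N := T.N
    N_ne_zero := T.N_ne_zero
    Θ := envelopingMap T.θ
    Θ_pow := by
      have h : ∀ n b c, (envelopingMap T.θ ^ n) (b ⊗ₜ[k] op c) =
          (T.θ ^ n) b ⊗ₜ op ((T.θ ^ n) c) := by
        intro n
        induction n with
        | zero => intro b c; rfl
        | succ n ih => intro b c; rw [pow_succ, AlgHom.mul_apply, envelopingMap_tmul, ih]; rfl
      refine AlgHom.ext fun z => ?_
      induction z using EnvelopingAlgebra.induction_on with
      | add x y hx hy => rw [map_add, hx, hy, map_add]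
      | tmul b c => rw [h, T.θ_pow]; rfl
    Θ_ι := fun s => by
      induction s using EnvelopingAlgebra.induction_on with
      | add x y hx hy => rw [map_add, map_add, hx, hy]
      | tmul a c => rw [envelopingMap_tmul, envelopingMap_tmul, T.θ_φ, T.θ_φ]
    π_Θ := fun e => by
      induction e using EnvelopingAlgebra.induction_on with
      | add x y hx hy => rw [map_add, map_add, hx, hy, map_add]
      | tmul b c => rw [envelopingMap_tmul, envelopingTrace_tmul, envelopingTrace_tmul, T.p_θ, T.p_θ] }

end Enveloping

/-! ### Normal forms in generalized Weyl algebras -/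

section NormalForm

open Polynomial

variable {k C : Type*} [Field k] [Ring C] [Algebra k C]

/-- The monomials `b ^ n`, `n ≥ 0`, and `c ^ (-n)`, `n < 0`. -/
def zmonomial (b c : C) : ℤ → C
  | Int.ofNat n => b ^ n
  | Int.negSucc n => c ^ (n + 1)

/-- The map `(fₙ) ↦ ∑ fₙ(a) bₙ` with `bₙ = b ^ n` for `n ≥ 0` and `bₙ = c ^ (-n)` for `n < 0`. -/
noncomputable def normalForm (k : Type*) [Field k] [Algebra k C] (a b c : C) :
    (ℤ →₀ k[X]) →ₗ[k] C :=
  Finsupp.lsum k fun n => (LinearMap.mulRight k (zmonomial b c n)) ∘ₗ (aeval a).toLinearMap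

theorem normalForm_single (a b c : C) (n : ℤ) (f : k[X]) :
    normalForm k a b c (Finsupp.single n f) = aeval a f * zmonomial b c n := by
  simp [normalForm]

theorem mul_aeval_of_mul_eq {a b : C} {g : k[X]} (h : b * a = aeval a g * b) (f : k[X]) :
    b * aeval a f = aeval a (f.comp g) * b := by
  induction f using Polynomial.induction_on' with
  | add p r hp hr => rw [map_add, mul_add, hp, hr, add_comp, map_add, add_mul]
  | monomial n t =>
    have hn : ∀ n : ℕ, b * a ^ n = aeval a g ^ n * b := by
      intro n
      induction n with
      | zero => simp
      | succ n ih => rw [pow_succ, ← mul_assoc, ih, mul_assoc, h, ← mul_assoc, ← pow_succ]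
    rw [aeval_monomial, monomial_comp, map_mul, aeval_C, map_pow, ← mul_assoc,
      ← Algebra.commutes, mul_assoc, hn, mul_assoc]

/-- The span of the normal forms contains `1` and is stable under left multiplication by the
generators: polynomials in `a` move past `b`, `c`, and adjacent `b c` or `c b` collapse to
polynomials in `a`. -/
theorem normalForm_surjective {a b c : C} {σ τ P Q : k[X]}
    (hb : b * a = aeval a σ * b) (hc : c * a = aeval a τ * c)
    (hbc : b * c = aeval a P) (hcb : c * b = aeval a Q)
    (hgen : Algebra.adjoin k {a, b, c} = ⊤) :
    Function.Surjective (normalForm k a b c) := by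
  rw [← LinearMap.range_eq_top]
  set R := LinearMap.range (normalForm k a b c) with hR
  have hmem : ∀ f n, aeval a f * zmonomial b c n ∈ R := fun f n => ⟨_, normalForm_single a b c n f⟩
  have key : ∀ d : C, (∀ (f : k[X]) (n : ℤ), d * (aeval a f * zmonomial b c n) ∈ R) → ∀ r ∈ R, d * r ∈ R := by
    rintro d hd _ ⟨F, rfl⟩
    induction F using Finsupp.induction_linear with
    | zero => simp
    | add F G hF hG => rw [map_add, mul_add]; exact R.add_mem hF hG
    | single n f => rw [normalForm_single]; exact hd f n
  refine Submodule.eq_top_of_adjoin_mul_mem hgen R ?_ ?_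
  · have := hmem 1 0
    rwa [map_one, one_mul, show (0 : ℤ) = Int.ofNat 0 from rfl, zmonomial, pow_zero] at this
  · rintro d (rfl | rfl | rfl)
    · refine key _ fun f n => ?_
      have := hmem (X * f) n
      rwa [map_mul, aeval_X, mul_assoc] at this
    · refine key _ fun f n => ?_
      rw [← mul_assoc, mul_aeval_of_mul_eq hb, mul_assoc]
      match n with
      | Int.ofNat n =>
        have := hmem (f.comp σ) (Int.ofNat (n + 1))
        rwa [zmonomial, pow_succ'] at this
      | Int.negSucc 0 =>
        have := hmem (f.comp σ * P) (Int.ofNat 0)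
        rw [zmonomial, pow_zero, mul_one, map_mul, ← hbc] at this
        rwa [zmonomial, zero_add, pow_one]
      | Int.negSucc (n + 1) =>
        have := hmem (f.comp σ * P) (Int.negSucc n)
        rw [zmonomial, map_mul, ← hbc] at this
        rwa [zmonomial, pow_succ', ← mul_assoc d, ← mul_assoc]
    · refine key _ fun f n => ?_
      rw [← mul_assoc, mul_aeval_of_mul_eq hc, mul_assoc]
      match n with
      | Int.negSucc n =>
        have := hmem (f.comp τ) (Int.negSucc (n + 1))
        rwa [zmonomial, pow_succ'] at this
      | Int.ofNat 0 =>
        have := hmem (f.comp τ) (Int.negSucc 0)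
        rw [zmonomial, zero_add, pow_one] at this
        rwa [zmonomial, pow_zero, mul_one]
      | Int.ofNat (n + 1) =>
        have := hmem (f.comp τ * Q) (Int.ofNat n)
        rw [zmonomial, map_mul, ← hcb] at this
        rwa [zmonomial, pow_succ', ← mul_assoc d, ← mul_assoc]

theorem map_zmonomial {D : Type*} [Ring D] [Algebra k D] (φ : C →ₐ[k] D) (b c : C) (n : ℤ) :
    φ (zmonomial b c n) = zmonomial (φ b) (φ c) n := by
  cases n <;> simp [zmonomial]

theorem zmonomial_pow_mul (b c : C) {N : ℕ} (hN : N ≠ 0) (n : ℤ) :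
    zmonomial (b ^ N) (c ^ N) n = zmonomial b c (N * n) := by
  match n with
  | Int.ofNat n =>
    rw [zmonomial, ← pow_mul, show (N : ℤ) * Int.ofNat n = Int.ofNat (N * n) by simp, zmonomial]
  | Int.negSucc n =>
    obtain ⟨M, hM⟩ := Nat.exists_eq_succ_of_ne_zero (mul_ne_zero hN (Nat.succ_ne_zero n))
    have : (N : ℤ) * Int.negSucc n = Int.negSucc M := by
      rw [Int.negSucc_eq, Int.negSucc_eq]
      have : ((N * n.succ : ℕ) : ℤ) = (M.succ : ℕ) := by rw [hM]
      push_cast at this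
      linarith
    rw [this, zmonomial, ← pow_mul, zmonomial]
    congr 1

end NormalForm

/-! ### The Laurent representation of the quantum Weyl algebra -/

namespace QWeyl

open Polynomial

variable {k : Type*} [Field k] {q γ : k}

/-- The shift by `n` composed with the substitution of `g`. -/
noncomputable def shiftSubst (n : ℤ) (g : k[X]) : Module.End k (ℤ →₀ k[X]) :=
  Finsupp.lsum k fun m => Finsupp.lsingle (m + n) ∘ₗ (aeval g).toLinearMap

theorem shiftSubst_single (n m : ℤ) (g f : k[X]) :
    shiftSubst n g (Finsupp.single m f) = Finsupp.single (m + n) (f.comp g) := by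
  simp [shiftSubst, aeval_def, comp, algebraMap_eq]

/-- Multiplication by a polynomial. -/
noncomputable def polyMul (g : k[X]) : Module.End k (ℤ →₀ k[X]) :=
  Finsupp.lsum k fun m => Finsupp.lsingle m ∘ₗ LinearMap.mulLeft k g

theorem polyMul_single (g f : k[X]) (m : ℤ) :
    polyMul g (Finsupp.single m f) = Finsupp.single m (g * f) := by
  simp [polyMul]

variable (q γ) in
/-- The action of `x` in the Laurent representation. -/
noncomputable def laurentX : Module.End k (ℤ →₀ k[X]) := shiftSubst 1 (C q⁻¹ * (X - C γ))

variable (q γ) in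
/-- The action of `y` in the Laurent representation. -/
noncomputable def laurentY : Module.End k (ℤ →₀ k[X]) :=
  shiftSubst (-1) (C q * X + C γ) * polyMul X

theorem laurentX_single (m : ℤ) (f : k[X]) :
    laurentX q γ (Finsupp.single m f) =
      Finsupp.single (m + 1) (f.comp (C q⁻¹ * (X - C γ))) := shiftSubst_single ..

theorem laurentY_single (m : ℤ) (f : k[X]) :
    laurentY q γ (Finsupp.single m f) =
      Finsupp.single (m - 1) ((X * f).comp (C q * X + C γ)) := by
  rw [laurentY, Module.End.mul_apply, polyMul_single, shiftSubst_single, sub_eq_add_neg]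

theorem C_mul_X_add_C_comp (hq : q ≠ 0) :
    (C q * X + C γ : k[X]).comp (C q⁻¹ * (X - C γ)) = X := by
  simp only [add_comp, mul_comp, C_comp, X_comp]
  rw [← mul_assoc, ← C_mul, mul_inv_cancel₀ hq, C_1, one_mul, sub_add_cancel]

theorem comp_C_mul_X_add_C (hq : q ≠ 0) :
    (C q⁻¹ * (X - C γ) : k[X]).comp (C q * X + C γ) = X := by
  simp only [sub_comp, mul_comp, C_comp, X_comp]
  rw [add_sub_cancel_right, ← mul_assoc, ← C_mul, inv_mul_cancel₀ hq, C_1, one_mul]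

theorem laurentX_mul_laurentY (hq : q ≠ 0) (m : ℤ) (f : k[X]) :
    laurentX q γ (laurentY q γ (Finsupp.single m f)) = Finsupp.single m (X * f) := by
  rw [laurentY_single, laurentX_single, comp_assoc, C_mul_X_add_C_comp hq, comp_X, sub_add_cancel]

theorem laurent_rel (hq : q ≠ 0) :
    laurentY q γ * laurentX q γ = q • (laurentX q γ * laurentY q γ) + algebraMap k _ γ := by
  refine Finsupp.lhom_ext fun m f => ?_
  rw [LinearMap.add_apply, LinearMap.smul_apply, Module.End.mul_apply, Module.End.mul_apply,
    laurentX_mul_laurentY hq, laurentX_single, laurentY_single, mul_comp, X_comp, comp_assoc,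
    comp_C_mul_X_add_C hq, comp_X, add_sub_cancel_right, Module.algebraMap_end_apply,
    Finsupp.smul_single, Finsupp.smul_single, ← Finsupp.single_add, add_mul, smul_eq_C_mul,
    smul_eq_C_mul, mul_assoc]

/-- The representation of the quantum Weyl algebra on skew Laurent polynomials. -/
noncomputable def laurentRep (γ : k) (hq : q ≠ 0) :
    QWeyl q γ →ₐ[k] Module.End k (ℤ →₀ k[X]) :=
  lift (C := Module.End k (ℤ →₀ k[X])) _ _ (laurent_rel hq)

theorem laurentRep_aeval (hq : q ≠ 0) (g f : k[X]) (m : ℤ) :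
    laurentRep γ hq (aeval (x q γ * y q γ) g) (Finsupp.single m f) =
      Finsupp.single m (g * f) := by
  have h : laurentRep γ hq (x q γ * y q γ) = polyMul X := by
    rw [map_mul, laurentRep, lift_x, lift_y]
    refine Finsupp.lhom_ext fun m f => ?_
    rw [Module.End.mul_apply, laurentX_mul_laurentY hq, polyMul_single]
  rw [← aeval_algHom_apply, h]
  induction g using Polynomial.induction_on' with
  | add p r hp hr => rw [map_add, LinearMap.add_apply, hp, hr, ← Finsupp.single_add, add_mul]
  | monomial n t =>
    have hn : ∀ n : ℕ, (polyMul X ^ n) (Finsupp.single m f) =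
        (Finsupp.single m (X ^ n * f) : ℤ →₀ k[X]) := by
      intro n
      induction n with
      | zero => simp
      | succ n ih => rw [pow_succ', Module.End.mul_apply, ih, polyMul_single, pow_succ', mul_assoc]
    rw [aeval_monomial, Module.End.mul_apply, hn, Module.algebraMap_end_apply,
      Finsupp.smul_single, smul_eq_C_mul, ← mul_assoc, C_mul_X_pow_eq_monomial]

theorem exists_laurentRep_zmonomial (hq : q ≠ 0) (n : ℤ) :
    ∃ s : k[X], s ≠ 0 ∧
      laurentRep γ hq (zmonomial (x q γ) (y q γ) n) (Finsupp.single 0 1) = Finsupp.single n s := by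
  have hx : ∀ n : ℕ, (laurentX q γ ^ n) (Finsupp.single 0 1) = Finsupp.single (n : ℤ) 1 := by
    intro n
    induction n with
    | zero => simp
    | succ n ih => rw [pow_succ', Module.End.mul_apply, ih, laurentX_single, one_comp]; push_cast; rfl
  have hy : ∀ n : ℕ, ∃ s : k[X], s ≠ 0 ∧
      (laurentY q γ ^ n) (Finsupp.single 0 1) = Finsupp.single (-(n : ℤ)) s := by
    intro n
    induction n with
    | zero => exact ⟨1, one_ne_zero, by simp⟩
    | succ n ih =>
      obtain ⟨s, hs, ih⟩ := ih
      refine ⟨(X * s).comp (C q * X + C γ), fun h => ?_, ?_⟩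
      -- The substitution `X ↦ q X + γ` is invertible, so it cannot kill the nonzero polynomial `X *
      -- s`.
      · have := congrArg (fun p => p.comp (C q⁻¹ * (X - C γ))) h
        simp only [comp_assoc, C_mul_X_add_C_comp hq, comp_X, zero_comp] at this
        exact mul_ne_zero X_ne_zero hs this
      · rw [pow_succ', Module.End.mul_apply, ih, laurentY_single]
        congr 1
        push_cast
        ring
  match n with
  | Int.ofNat n =>
    refine ⟨1, one_ne_zero, ?_⟩
    rw [zmonomial, map_pow, laurentRep, lift_x, hx]
    rfl
  | Int.negSucc n =>
    obtain ⟨s, hs, h⟩ := hy (n + 1)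
    refine ⟨s, hs, ?_⟩
    rw [zmonomial, map_pow, laurentRep, lift_y, h]
    rfl

/-- Applying normal forms to the vacuum vector. -/
theorem exists_laurentRep_normalForm (hq : q ≠ 0) :
    ∃ s : ℤ → k[X], (∀ n, s n ≠ 0) ∧ ∀ n f,
      laurentRep γ hq (aeval (x q γ * y q γ) f * zmonomial (x q γ) (y q γ) n) (Finsupp.single 0 1) =
        Finsupp.single n (f * s n) := by
  choose s hs h using exists_laurentRep_zmonomial (γ := γ) hq
  exact ⟨s, hs, fun n f => by rw [map_mul, Module.End.mul_apply, h, laurentRep_aeval]⟩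

theorem x_mul_xy (hq : q ≠ 0) :
    x q γ * (x q γ * y q γ) =
      aeval (x q γ * y q γ) (C q⁻¹ * X - C (q⁻¹ * γ)) * x q γ := by
  simp only [map_sub, map_mul, aeval_C, aeval_X]
  nth_rewrite 1 [x_mul_y hq]
  rw [mul_smul_comm, mul_sub, sub_mul, smul_sub, ← Algebra.smul_def, smul_mul_assoc,
    ← Algebra.commutes, mul_assoc, ← map_mul, ← Algebra.smul_def, ← Algebra.smul_def, smul_smul]

theorem y_mul_xy :
    y q γ * (x q γ * y q γ) = aeval (x q γ * y q γ) (C q * X + C γ) * y q γ := by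
  simp only [map_add, map_mul, aeval_C, aeval_X]
  rw [← mul_assoc, y_mul_x, Algebra.smul_def]

theorem y_mul_x_eq : y q γ * x q γ = aeval (x q γ * y q γ) (C q * X + C γ) := by
  simp only [map_add, map_mul, aeval_C, aeval_X]
  rw [y_mul_x, Algebra.smul_def]

theorem normalForm_surjective (hq : q ≠ 0) :
    Function.Surjective (normalForm k (x q γ * y q γ) (x q γ) (y q γ)) := by
  refine _root_.normalForm_surjective (x_mul_xy hq) y_mul_xy (P := X) (by rw [aeval_X])
    y_mul_x_eq ?_
  rw [eq_top_iff, ← adjoin_eq_top]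
  exact Algebra.adjoin_mono (by simp)

end QWeyl

/-! ### `q`-integers -/

theorem qInt_zero (q : ℝ) : qInt q 0 = 0 := by simp [qInt]

theorem qInt_succ {q : ℝ} (hq : q ≠ 0) (n : ℤ) : qInt q (n + 1) = q * qInt q n + 1 := by
  unfold qInt
  split_ifs with h
  · push_cast; rw [h]; ring
  · have : 1 - q ≠ 0 := sub_ne_zero.2 (Ne.symm h)
    rw [zpow_add_one₀ hq]
    field_simp
    ring

theorem qInt_add {q : ℝ} (hq : q ≠ 0) (m n : ℤ) :
    qInt q (m + n) = q ^ m * qInt q n + qInt q m := by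
  unfold qInt
  split_ifs with h
  · rw [h]; push_cast; simp; ring
  · have : 1 - q ≠ 0 := sub_ne_zero.2 (Ne.symm h)
    rw [zpow_add₀ hq]
    field_simp
    ring

theorem qInt_ne_zero {N : ℕ} {q : ℝ} (hroots : q = -1 → N ≤ 2) {n : ℕ}
    (h1 : 1 ≤ n) (hn : n < N) : qInt q n ≠ 0 := by
  unfold qInt
  split_ifs with h
  · simp; omega
  · have : 1 - q ≠ 0 := sub_ne_zero.2 (Ne.symm h)
    refine div_ne_zero (sub_ne_zero.2 fun h' => ?_) this
    rw [zpow_natCast] at h'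
    -- The only real roots of unity are `1` and `-1`; the latter needs `n` even, impossible for `1 ≤
    -- n < N ≤ 2`.
    obtain h2 | ⟨h2, h3⟩ := (pow_eq_one_iff_cases (a := q) (n := n)).1 h'.symm |>.resolve_left (by omega)
    · exact h h2
    · have := hroots h2
      obtain ⟨m, hm⟩ := h3
      omega

section ConeFactor

open Polynomial

variable {q γ : ℝ}

theorem coneFactor_zero : coneFactor q γ 0 = X := by
  simp [coneFactor, qInt_zero]

theorem coneFactor_succ (hq : q ≠ 0) (n : ℤ) :
    coneFactor q γ (n + 1) = C (q : ℂ) * coneFactor q γ n + C (γ : ℂ) := by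
  unfold coneFactor
  rw [qInt_succ hq, zpow_add_one₀ hq]
  simp only [Complex.ofReal_mul, Complex.ofReal_add, Complex.ofReal_one, C_mul, C_add, C_1]
  ring

/-- Two linear polynomials are coprime when their coefficient determinant is nonzero; here it equals
`q ^ (-m) γ [l + m]_q`. -/
theorem isCoprime_coneFactor {N : ℕ} (hq : q ≠ 0) (hγ : γ ≠ 0) (hroots : q = -1 → N ≤ 2)
    {l m : ℕ} (h1 : 1 ≤ l + m) (hN : l + m < N) :
    IsCoprime (coneFactor q γ l) (coneFactor q γ (-(m : ℤ))) := by
  have hne := qInt_ne_zero hroots h1 hN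
  have hc : (γ * qInt q (l + m : ℕ) : ℝ) ≠ 0 := mul_ne_zero hγ hne
  have hs : qInt q (l + m : ℕ) = q ^ (l : ℤ) * qInt q m + qInt q l := by
    push_cast; exact qInt_add hq _ _
  have h0 : q ^ (-(m : ℤ)) * qInt q m + qInt q (-(m : ℤ)) = 0 := by
    rw [← qInt_add hq, neg_add_cancel, qInt_zero]
  have hz : q ^ (-(m : ℤ)) * q ^ (m : ℤ) = 1 := by
    rw [← zpow_add₀ hq, neg_add_cancel, zpow_zero]
  set d : ℝ := γ * qInt q (l + m : ℕ) with hd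
  have hdet : q ^ (m : ℤ) * (q ^ (-(m : ℤ)) * (γ * qInt q l) -
      q ^ (l : ℤ) * (γ * qInt q (-(m : ℤ)))) = d := by
    have : qInt q (-(m : ℤ)) = -(q ^ (-(m : ℤ)) * qInt q m) := by linarith
    rw [this, hd, hs]
    linear_combination (γ * qInt q l + q ^ (l : ℤ) * γ * qInt q m) * hz
  -- Constant Bézout coefficients by Cramer's rule: leading coefficients crosswise, divided by the
  -- determinant `q ^ (-m) d`.
  refine ⟨C (((d⁻¹ * q ^ (m : ℤ) * q ^ (-(m : ℤ)) : ℝ) : ℂ)),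
    C (((-(d⁻¹ * q ^ (m : ℤ) * q ^ (l : ℤ)) : ℝ) : ℂ)), ?_⟩
  unfold coneFactor
  have e1 : d⁻¹ * q ^ (m : ℤ) * q ^ (-(m : ℤ)) * q ^ (l : ℤ) +
      -(d⁻¹ * q ^ (m : ℤ) * q ^ (l : ℤ)) * q ^ (-(m : ℤ)) = 0 := by ring
  have e2 : d⁻¹ * q ^ (m : ℤ) * q ^ (-(m : ℤ)) * (γ * qInt q l) +
      -(d⁻¹ * q ^ (m : ℤ) * q ^ (l : ℤ)) * (γ * qInt q (-(m : ℤ))) = 1 := by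
    rw [← inv_mul_cancel₀ hc]
    linear_combination d⁻¹ * hdet
  calc _ = C (((d⁻¹ * q ^ (m : ℤ) * q ^ (-(m : ℤ)) * q ^ (l : ℤ) +
      -(d⁻¹ * q ^ (m : ℤ) * q ^ (l : ℤ)) * q ^ (-(m : ℤ)) : ℝ) : ℂ)) * X +
      C (((d⁻¹ * q ^ (m : ℤ) * q ^ (-(m : ℤ)) * (γ * qInt q l) +
      -(d⁻¹ * q ^ (m : ℤ) * q ^ (l : ℤ)) * (γ * qInt q (-(m : ℤ))) : ℝ) : ℂ)) := by
        simp only [Complex.ofReal_add, Complex.ofReal_mul, C_add, C_mul]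
        ring
    _ = 1 := by rw [e1, e2]; simp

theorem isCoprime_prod_coneFactor {N : ℕ} (hq : q ≠ 0) (hγ : γ ≠ 0) (hroots : q = -1 → N ≤ 2)
    {g h : ℕ} (hgh : g + h = N) :
    IsCoprime (∏ l ∈ Finset.Icc 1 g, coneFactor q γ (l : ℤ))
      (∏ m ∈ Finset.range h, coneFactor q γ (-(m : ℤ))) := by
  refine IsCoprime.prod_left fun l hl => IsCoprime.prod_right fun m hm => ?_
  rw [Finset.mem_Icc] at hl
  rw [Finset.mem_range] at hm
  exact isCoprime_coneFactor hq hγ hroots (by omega) (by omega)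

end ConeFactor

/-! ### Powers of `x` and `y` as products of linear factors in `x y`. -/

namespace QWeyl

open Polynomial

variable {q γ : ℝ}

theorem aeval_coneFactor_succ (hq : q ≠ 0) {C : Type*} [Ring C] [Algebra ℂ C] (a : C) (n : ℤ) :
    aeval a (coneFactor q γ (n + 1)) =
      (q : ℂ) • aeval a (coneFactor q γ n) + algebraMap ℂ C γ := by
  rw [coneFactor_succ hq, map_add, map_mul, aeval_C, aeval_C, Algebra.smul_def]

variable (q γ) in
/-- The element `x y`. -/
noncomputable def xy : QWeyl (q : ℂ) (γ : ℂ) := x _ _ * y _ _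

theorem aeval_coneFactor_pred (hq : q ≠ 0) {C : Type*} [Ring C] [Algebra ℂ C] (a : C) (n : ℤ) :
    aeval a (coneFactor q γ (n - 1)) =
      (q : ℂ)⁻¹ • (aeval a (coneFactor q γ n) - algebraMap ℂ C γ) := by
  have := aeval_coneFactor_succ (γ := γ) hq a (n - 1)
  rw [sub_add_cancel] at this
  rw [this, add_sub_cancel_right, smul_smul, inv_mul_cancel₀ (Complex.ofReal_ne_zero.2 hq),
    one_smul]

theorem xy_mul_x_pow (hq : q ≠ 0) (n : ℕ) :
    xy q γ * x _ _ ^ n = x _ _ ^ n * aeval (xy q γ) (coneFactor q γ n) := by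
  induction n with
  | zero => simp [coneFactor_zero]
  | succ n ih =>
    have h1 : xy q γ * x _ _ = x _ _ * ((q : ℂ) • xy q γ + algebraMap ℂ _ γ) := by
      rw [xy, mul_assoc, y_mul_x]
    push_cast
    rw [pow_succ', ← mul_assoc, h1, mul_assoc, add_mul, smul_mul_assoc, ih,
      Algebra.commutes, ← mul_smul_comm, ← mul_add, ← aeval_coneFactor_succ hq, mul_assoc]

theorem y_pow_mul_xy (hq : q ≠ 0) (n : ℕ) :
    y _ _ ^ n * xy q γ = aeval (xy q γ) (coneFactor q γ n) * y _ _ ^ n := by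
  induction n with
  | zero => simp [coneFactor_zero]
  | succ n ih =>
    have h1 : y _ _ * xy q γ = ((q : ℂ) • xy q γ + algebraMap ℂ _ γ) * y _ _ := by
      rw [xy, ← mul_assoc, y_mul_x]
    push_cast
    rw [pow_succ, mul_assoc, h1, ← mul_assoc, mul_add, mul_smul_comm, ih,
      ← Algebra.commutes, ← smul_mul_assoc, ← add_mul, ← aeval_coneFactor_succ hq, mul_assoc]

theorem x_pow_mul_xy (hq : q ≠ 0) (n : ℕ) :
    x _ _ ^ n * xy q γ = aeval (xy q γ) (coneFactor q γ (-(n : ℤ))) * x _ _ ^ n := by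
  induction n with
  | zero => simp [coneFactor_zero]
  | succ n ih =>
    have h1 : x _ _ * xy q γ = ((q : ℂ)⁻¹ • (xy q γ - algebraMap ℂ _ γ)) * x _ _ := by
      nth_rewrite 1 [xy]
      rw [x_mul_y (Complex.ofReal_ne_zero.2 hq), mul_smul_comm, mul_sub, smul_mul_assoc, sub_mul,
        ← mul_assoc, Algebra.commutes]
      rfl
    push_cast
    rw [pow_succ, mul_assoc, h1, ← mul_assoc, mul_smul_comm, mul_sub, ih,
      ← Algebra.commutes, ← sub_mul, ← smul_mul_assoc, neg_add, ← sub_eq_add_neg,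
      aeval_coneFactor_pred hq, mul_assoc]

theorem x_pow_mul_y_pow (hq : q ≠ 0) (n : ℕ) :
    (x (q : ℂ) (γ : ℂ)) ^ n * y _ _ ^ n =
      aeval (xy q γ) (∏ l ∈ Finset.range n, coneFactor q γ (-(l : ℤ))) := by
  induction n with
  | zero => simp
  | succ n ih =>
    rw [Finset.prod_range_succ, mul_comm (Finset.prod _ _), map_mul, ← ih, ← mul_assoc,
      ← x_pow_mul_xy hq, pow_succ, pow_succ', xy]
    simp only [mul_assoc]

theorem y_pow_mul_x_pow (hq : q ≠ 0) (n : ℕ) :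
    (y (q : ℂ) (γ : ℂ)) ^ n * x _ _ ^ n =
      aeval (xy q γ) (∏ l ∈ Finset.Icc 1 n, coneFactor q γ (l : ℤ)) := by
  induction n with
  | zero => simp
  | succ n ih =>
    rw [Finset.prod_Icc_succ_top (by omega), mul_comm (Finset.prod _ _), map_mul, ← ih,
      ← mul_assoc, Nat.cast_succ, aeval_coneFactor_succ hq, add_mul, smul_mul_assoc,
      ← y_pow_mul_xy hq, Algebra.commutes, ← mul_smul_comm, ← mul_add, pow_succ, pow_succ']
    rw [show (q : ℂ) • xy q γ + algebraMap ℂ _ (γ : ℂ) = y _ _ * x _ _ from (y_mul_x _ _).symm]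
    simp only [mul_assoc]

end QWeyl

/-! ### The quantum cone and its embedding into the quantum Weyl algebra. -/

namespace QuantumCone

open Polynomial

variable (N : ℕ) (q γ : ℝ)

/-- The quotient map from the free algebra. -/
noncomputable def mk : FreeAlgebra ℂ ConeGen →ₐ[ℂ] QuantumCone N q γ :=
  RingQuot.mkAlgHom ℂ (Rel N q γ)

/-- The generator `a`. -/
noncomputable def a : QuantumCone N q γ := mk N q γ genA

/-- The generator `b`. -/
noncomputable def b : QuantumCone N q γ := mk N q γ genB

/-- The generator `b*`. -/
noncomputable def bstar : QuantumCone N q γ := mk N q γ genBstar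

theorem a_mul_b : a N q γ * b N q γ =
    ((q ^ N : ℝ) : ℂ) • (b N q γ * a N q γ) + ((γ * qInt q N : ℝ) : ℂ) • b N q γ := by
  have : mk N q γ _ = mk N q γ _ := RingQuot.mkAlgHom_rel ℂ (Rel.comm (N := N) (q := q) (γ := γ))
  simp only [map_mul, map_add, map_smul] at this
  exact this

theorem bstar_mul_a : bstar N q γ * a N q γ =
    ((q ^ N : ℝ) : ℂ) • (a N q γ * bstar N q γ) + ((γ * qInt q N : ℝ) : ℂ) • bstar N q γ := by
  have : mk N q γ _ = mk N q γ _ :=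
    RingQuot.mkAlgHom_rel ℂ (Rel.adjoint_comm (N := N) (q := q) (γ := γ))
  simp only [map_mul, map_add, map_smul] at this
  exact this

theorem b_mul_bstar : b N q γ * bstar N q γ =
    aeval (a N q γ) (∏ l ∈ Finset.range N, coneFactor q γ (-(l : ℤ))) := by
  have : mk N q γ _ = mk N q γ _ :=
    RingQuot.mkAlgHom_rel ℂ (Rel.b_bstar (N := N) (q := q) (γ := γ))
  rwa [map_mul, ← aeval_algHom_apply] at this

theorem bstar_mul_b : bstar N q γ * b N q γ =
    aeval (a N q γ) (∏ l ∈ Finset.Icc 1 N, coneFactor q γ (l : ℤ)) := by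
  have : mk N q γ _ = mk N q γ _ :=
    RingQuot.mkAlgHom_rel ℂ (Rel.bstar_b (N := N) (q := q) (γ := γ))
  rwa [map_mul, ← aeval_algHom_apply] at this

theorem adjoin_eq_top : Algebra.adjoin ℂ {a N q γ, b N q γ, bstar N q γ} = ⊤ := by
  refine Eq.trans ?_ (RingQuot.adjoin_range_mkAlgHom_ι (Rel N q γ))
  congr 1
  ext c
  constructor
  · rintro (rfl | rfl | rfl)
    exacts [⟨ConeGen.a, rfl⟩, ⟨ConeGen.b, rfl⟩, ⟨ConeGen.bstar, rfl⟩]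
  · rintro ⟨⟨⟩, rfl⟩
    exacts [Or.inl rfl, Or.inr (Or.inl rfl), Or.inr (Or.inr rfl)]

variable {N q γ}

section Lift

variable {C : Type*} [Ring C] [Algebra ℂ C]

/-- The universal property of the quantum cone. -/
noncomputable def lift (A B B' : C)
    (h₁ : A * B = ((q ^ N : ℝ) : ℂ) • (B * A) + ((γ * qInt q N : ℝ) : ℂ) • B)
    (h₂ : B' * A = ((q ^ N : ℝ) : ℂ) • (A * B') + ((γ * qInt q N : ℝ) : ℂ) • B')
    (h₃ : B * B' = aeval A (∏ l ∈ Finset.range N, coneFactor q γ (-(l : ℤ))))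
    (h₄ : B' * B = aeval A (∏ l ∈ Finset.Icc 1 N, coneFactor q γ (l : ℤ))) :
    QuantumCone N q γ →ₐ[ℂ] C :=
  RingQuot.liftAlgHom ℂ ⟨FreeAlgebra.lift ℂ fun
      | ConeGen.a => A
      | ConeGen.b => B
      | ConeGen.bstar => B', by
    rintro _ _ (_ | _ | _ | _)
    · simpa only [map_mul, map_add, map_smul, FreeAlgebra.lift_ι_apply] using h₁
    · simpa only [map_mul, map_add, map_smul, FreeAlgebra.lift_ι_apply] using h₂
    · simpa only [map_mul, ← aeval_algHom_apply, FreeAlgebra.lift_ι_apply] using h₃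
    · simpa only [map_mul, ← aeval_algHom_apply, FreeAlgebra.lift_ι_apply] using h₄⟩

variable {A B B' : C}
    {h₁ : A * B = ((q ^ N : ℝ) : ℂ) • (B * A) + ((γ * qInt q N : ℝ) : ℂ) • B}
    {h₂ : B' * A = ((q ^ N : ℝ) : ℂ) • (A * B') + ((γ * qInt q N : ℝ) : ℂ) • B'}
    {h₃ : B * B' = aeval A (∏ l ∈ Finset.range N, coneFactor q γ (-(l : ℤ)))}
    {h₄ : B' * B = aeval A (∏ l ∈ Finset.Icc 1 N, coneFactor q γ (l : ℤ))}

@[simp]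
theorem lift_a : lift A B B' h₁ h₂ h₃ h₄ (a N q γ) = A :=
  (RingQuot.liftAlgHom_mkAlgHom_apply ..).trans (FreeAlgebra.lift_ι_apply ..)

@[simp]
theorem lift_b : lift A B B' h₁ h₂ h₃ h₄ (b N q γ) = B :=
  (RingQuot.liftAlgHom_mkAlgHom_apply ..).trans (FreeAlgebra.lift_ι_apply ..)

@[simp]
theorem lift_bstar : lift A B B' h₁ h₂ h₃ h₄ (bstar N q γ) = B' :=
  (RingQuot.liftAlgHom_mkAlgHom_apply ..).trans (FreeAlgebra.lift_ι_apply ..)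

theorem hom_ext {f g : QuantumCone N q γ →ₐ[ℂ] C} (ha : f (a N q γ) = g (a N q γ))
    (hb : f (b N q γ) = g (b N q γ)) (hb' : f (bstar N q γ) = g (bstar N q γ)) : f = g := by
  refine RingQuot.ringQuot_ext' ℂ f g (FreeAlgebra.hom_ext (funext fun i => ?_))
  cases i
  exacts [ha, hb, hb']

end Lift

/-- The rescaling `b ↦ c b`, `b* ↦ c⁻¹ b*`. -/
noncomputable def scale {c : ℂ} (hc : c ≠ 0) : QuantumCone N q γ →ₐ[ℂ] QuantumCone N q γ :=
  lift (a N q γ) (c • b N q γ) (c⁻¹ • bstar N q γ)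
    (by rw [mul_smul_comm, smul_mul_assoc, a_mul_b]; module)
    (by rw [mul_smul_comm, smul_mul_assoc, bstar_mul_a]; module)
    (by rw [smul_mul_smul_comm, mul_inv_cancel₀ hc, one_smul, b_mul_bstar])
    (by rw [smul_mul_smul_comm, inv_mul_cancel₀ hc, one_smul, bstar_mul_b])

theorem scale_comp_scale {c d : ℂ} (hc : c ≠ 0) (hd : d ≠ 0) (hcd : c * d = 1) :
    (scale hc).comp (scale hd) = AlgHom.id ℂ (QuantumCone N q γ) := by
  refine hom_ext ?_ ?_ ?_
  · simp [scale]
  · simp [scale, smul_smul, mul_comm d, hcd]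
  · simp [scale, smul_smul, ← mul_inv, hcd, mul_comm d⁻¹]

/-- The rescaling automorphism `b ↦ c b`, `b* ↦ c⁻¹ b*`. -/
noncomputable def scaleEquiv {c : ℂ} (hc : c ≠ 0) : QuantumCone N q γ ≃ₐ[ℂ] QuantumCone N q γ :=
  AlgEquiv.ofAlgHom (scale hc) (scale (inv_ne_zero hc))
    (scale_comp_scale _ _ (mul_inv_cancel₀ hc)) (scale_comp_scale _ _ (inv_mul_cancel₀ hc))

theorem b_mul_a (hq : q ≠ 0) : b N q γ * a N q γ =
    aeval (a N q γ) (C ((q ^ N : ℝ) : ℂ)⁻¹ * X -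
      C (((q ^ N : ℝ) : ℂ)⁻¹ * ((γ * qInt q N : ℝ) : ℂ))) * b N q γ := by
  have h := a_mul_b N q γ
  have hqN : ((q ^ N : ℝ) : ℂ) ≠ 0 := Complex.ofReal_ne_zero.2 (pow_ne_zero _ hq)
  simp only [map_sub, map_mul, aeval_C, aeval_X]
  rw [sub_mul, mul_assoc, h, mul_add, ← map_mul, ← Algebra.smul_def, ← Algebra.smul_def,
    ← Algebra.smul_def, smul_smul, smul_smul, inv_mul_cancel₀ hqN, one_smul, add_sub_cancel_right]

theorem bstar_mul_a' : bstar N q γ * a N q γ =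
    aeval (a N q γ) (C ((q ^ N : ℝ) : ℂ) * X + C ((γ * qInt q N : ℝ) : ℂ)) * bstar N q γ := by
  simp only [map_add, map_mul, aeval_C, aeval_X]
  rw [bstar_mul_a, add_mul, Algebra.smul_def, Algebra.smul_def, mul_assoc]

theorem normalForm_surjective (hq : q ≠ 0) :
    Function.Surjective (normalForm ℂ (a N q γ) (b N q γ) (bstar N q γ)) :=
  _root_.normalForm_surjective (b_mul_a hq) bstar_mul_a' (b_mul_bstar N q γ) (bstar_mul_b N q γ)
    (adjoin_eq_top N q γ)

/-- The embedding of the quantum cone into the quantum Weyl algebra, `a ↦ x y`, `b ↦ x ^ N`,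
`b* ↦ y ^ N`. -/
noncomputable def toWeyl (N : ℕ) (γ : ℝ) (hq : q ≠ 0) :
    QuantumCone N q γ →ₐ[ℂ] QWeyl (q : ℂ) (γ : ℂ) :=
  lift (QWeyl.xy q γ) (QWeyl.x _ _ ^ N) (QWeyl.y _ _ ^ N)
    (by
      rw [QWeyl.xy_mul_x_pow hq, coneFactor, map_add, map_mul, aeval_C, aeval_C, aeval_X, mul_add,
        ← Algebra.smul_def, mul_smul_comm, ← Algebra.commutes, ← Algebra.smul_def, zpow_natCast])
    (by
      rw [QWeyl.y_pow_mul_xy hq, coneFactor, map_add, map_mul, aeval_C, aeval_C, aeval_X, add_mul,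
        ← Algebra.smul_def, smul_mul_assoc, ← Algebra.smul_def, zpow_natCast])
    (QWeyl.x_pow_mul_y_pow hq N) (QWeyl.y_pow_mul_x_pow hq N)

variable (hq : q ≠ 0)

@[simp]
theorem toWeyl_a : toWeyl N γ hq (a N q γ) = QWeyl.xy q γ := lift_a

@[simp]
theorem toWeyl_b : toWeyl N γ hq (b N q γ) = QWeyl.x _ _ ^ N := lift_b

@[simp]
theorem toWeyl_bstar : toWeyl N γ hq (bstar N q γ) = QWeyl.y _ _ ^ N := lift_bstar

/-- Used twice: for `c = ζ` it shows that the image is `θ`-invariant, and for `c = q⁻¹` it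
identifies the twist on the cone. -/
theorem toWeyl_scale {c : ℂ} (hc : c ≠ 0) (z : QuantumCone N q γ) :
    toWeyl N γ hq (scale (pow_ne_zero N hc) z) = QWeyl.scale hc (toWeyl N γ hq z) := by
  refine AlgHom.congr_fun (φ₁ := (toWeyl N γ hq).comp (scale (pow_ne_zero N hc)))
    (φ₂ := (QWeyl.scale hc).comp (toWeyl N γ hq)) (hom_ext ?_ ?_ ?_) z
  · simp [scale, QWeyl.xy, smul_smul, inv_mul_cancel₀ hc]
  · simp [scale, _root_.smul_pow]
  · simp [scale, _root_.smul_pow]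

theorem toWeyl_normalForm (hN : N ≠ 0) (n : ℤ) (f : ℂ[X]) :
    toWeyl N γ hq (aeval (a N q γ) f * zmonomial (b N q γ) (bstar N q γ) n) =
      aeval (QWeyl.xy q γ) f * zmonomial (QWeyl.x _ _) (QWeyl.y _ _) (N * n) := by
  rw [map_mul, ← aeval_algHom_apply, map_zmonomial, toWeyl_a, toWeyl_b, toWeyl_bstar,
    zmonomial_pow_mul _ _ hN]

/-- Applied to the vacuum of the Laurent representation, the image of a normal form shows its `n`-th
coefficient, times a nonzero polynomial, in degree `N n`. -/
theorem toWeyl_injective (hN : N ≠ 0) : Function.Injective (toWeyl N γ hq) := by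
  rw [injective_iff_map_eq_zero]
  intro z hz
  obtain ⟨F, rfl⟩ := normalForm_surjective (N := N) (γ := γ) hq z
  obtain ⟨s, hs, h⟩ :=
    QWeyl.exists_laurentRep_normalForm (γ := (γ : ℂ)) (Complex.ofReal_ne_zero.2 hq)
  have key : ∀ (F : ℤ →₀ ℂ[X]) (n : ℤ),
      QWeyl.laurentRep (γ : ℂ) (Complex.ofReal_ne_zero.2 hq)
        (toWeyl N γ hq (normalForm ℂ (a N q γ) (b N q γ) (bstar N q γ) F))
          (Finsupp.single 0 1) (N * n) = F n * s (N * n) := by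
    intro F n
    induction F using Finsupp.induction_linear with
    | zero => simp
    | add F G hF hG =>
      simp only [map_add, LinearMap.add_apply, Finsupp.add_apply, hF, hG, add_mul]
    | single m f =>
      rw [normalForm_single, toWeyl_normalForm hq hN]
      refine (congrArg (fun p : ℤ →₀ ℂ[X] => p (N * n)) (h (N * m) f)).trans ?_
      classical
      have : (N : ℤ) * m = N * n ↔ m = n := by
        rw [mul_right_inj' (Nat.cast_ne_zero.2 hN)]
      simp only [Finsupp.single_apply, this]
      split_ifs with hmn
      · rw [hmn]
      · rw [zero_mul]
  have hF : F = 0 := by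
    ext1 n
    have := key F n
    rw [hz, map_zero, LinearMap.zero_apply, Finsupp.zero_apply] at this
    exact (mul_eq_zero.1 this.symm).resolve_right (hs _)
  rw [hF, map_zero]

end QuantumCone

/-! ### The cone as the invariants of a cyclic group acting on the quantum Weyl algebra. -/

namespace QWeyl

variable {k : Type*} [Field k] {q γ : k}

theorem scale_pow {c : k} (hc : c ≠ 0) (n : ℕ) :
    (scale hc : QWeyl q γ →ₐ[k] QWeyl q γ) ^ n = scale (pow_ne_zero n hc) := by
  induction n with
  | zero => exact hom_ext (by simp) (by simp)
  | succ n ih =>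
    rw [pow_succ, ih]
    refine hom_ext ?_ ?_
    · rw [AlgHom.mul_apply, scale_x, map_smul, scale_x, scale_x, smul_smul, pow_succ']
    · rw [AlgHom.mul_apply, scale_y, map_smul, scale_y, scale_y, smul_smul, pow_succ', mul_inv]

theorem scale_one {c : k} (hc : c ≠ 0) (h : c = 1) :
    (scale hc : QWeyl q γ →ₐ[k] QWeyl q γ) = 1 := by
  subst h
  exact hom_ext (by simp) (by simp)

theorem scale_xy {c : k} (hc : c ≠ 0) : scale hc (x q γ * y q γ) = x q γ * y q γ := by
  rw [map_mul, scale_x, scale_y, smul_mul_smul_comm, mul_inv_cancel₀ hc, one_smul]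

theorem scale_aeval {c : k} (hc : c ≠ 0) (f : Polynomial k) :
    scale hc (Polynomial.aeval (x q γ * y q γ) f) = Polynomial.aeval (x q γ * y q γ) f := by
  rw [← Polynomial.aeval_algHom_apply, scale_xy]

theorem scale_zmonomial {c : k} (hc : c ≠ 0) (n : ℤ) :
    scale hc (zmonomial (x q γ) (y q γ) n) = c ^ n • zmonomial (x q γ) (y q γ) n := by
  match n with
  | Int.ofNat n => simp [zmonomial, smul_pow]
  | Int.negSucc n => simp [zmonomial, smul_pow]

theorem scale_normal {c : k} (hc : c ≠ 0) (n : ℤ) (f : Polynomial k) :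
    scale hc (Polynomial.aeval (x q γ * y q γ) f * zmonomial (x q γ) (y q γ) n) =
      c ^ n • (Polynomial.aeval (x q γ * y q γ) f * zmonomial (x q γ) (y q γ) n) := by
  rw [map_mul, scale_aeval, scale_zmonomial, mul_smul_comm]

theorem span_eigenvectors (hq : q ≠ 0) {N : ℕ} {ζ : k} (hζ : ζ ≠ 0) (hN : ζ ^ N = 1) :
    Submodule.span k {b : QWeyl q γ | ∃ c : k, c ^ N = 1 ∧ scale hζ b = c • b} = ⊤ := by
  rw [eq_top_iff]
  intro b _
  obtain ⟨F, rfl⟩ := normalForm_surjective (γ := γ) hq b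
  induction F using Finsupp.induction_linear with
  | zero => simp
  | add F G hF hG => rw [map_add]; exact Submodule.add_mem _ (hF trivial) (hG trivial)
  | single n f =>
    refine Submodule.subset_span ⟨ζ ^ n, ?_, ?_⟩
    · rw [← zpow_natCast, zpow_comm, zpow_natCast, hN, one_zpow]
    · rw [normalForm_single, scale_normal]

end QWeyl

namespace QuantumCone

open Polynomial

variable {N : ℕ} {q γ : ℝ}

theorem scale_toWeyl (hq : q ≠ 0) {ζ : ℂ} (hζ : ζ ≠ 0) (hN : ζ ^ N = 1)
    (z : QuantumCone N q γ) : QWeyl.scale hζ (toWeyl N γ hq z) = toWeyl N γ hq z := by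
  rw [← toWeyl_scale]
  congr 1
  refine AlgHom.congr_fun (φ₂ := AlgHom.id ℂ _) (hom_ext ?_ ?_ ?_) z <;> simp [scale, hN]

/-- A normal form of degree `n` has eigenvalue `ζ ^ n`, so averaging keeps only degrees divisible by
`N`, which are the normal forms of the cone. -/
theorem cyclicAverage_mem_range (hN : N ≠ 0) (hq : q ≠ 0) {ζ : ℂ} (hζ : IsPrimitiveRoot ζ N)
    (z : QWeyl (q : ℂ) (γ : ℂ)) :
    cyclicAverage N (QWeyl.scale (hζ.ne_zero hN)) z ∈
      LinearMap.range (toWeyl N γ hq).toLinearMap := by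
  classical
  obtain ⟨F, rfl⟩ := QWeyl.normalForm_surjective (γ := (γ : ℂ)) (Complex.ofReal_ne_zero.2 hq) z
  induction F using Finsupp.induction_linear with
  | zero => simp
  | add F G hF hG => rw [map_add, map_add]; exact Submodule.add_mem _ hF hG
  | single n f =>
    have hN' : (N : ℂ) ≠ 0 := Nat.cast_ne_zero.2 hN
    rw [normalForm_single, cyclicAverage_of_eigen hN' _ (QWeyl.scale_normal _ n f)]
    · split_ifs with h
      · obtain ⟨m, rfl⟩ := (hζ.zpow_eq_one_iff_dvd n).1 h
        exact ⟨_, toWeyl_normalForm hq hN m f⟩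
      · exact Submodule.zero_mem _
    · rw [← zpow_natCast, zpow_comm, zpow_natCast, hζ.pow_eq_one, one_zpow]

/-- The trace from the quantum Weyl algebra to the quantum cone. -/
noncomputable def weylTrace (γ : ℝ) (hN : N ≠ 0) (hq : q ≠ 0) {ζ : ℂ} (hζ : IsPrimitiveRoot ζ N) :
    QWeyl (q : ℂ) (γ : ℂ) →ₗ[ℂ] QuantumCone N q γ :=
  (LinearEquiv.ofInjective (toWeyl N γ hq).toLinearMap (toWeyl_injective hq hN)).symm ∘ₗ
    (cyclicAverage N (QWeyl.scale (hζ.ne_zero hN))).codRestrict _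
      (cyclicAverage_mem_range hN hq hζ)

theorem toWeyl_weylTrace (hN : N ≠ 0) (hq : q ≠ 0) {ζ : ℂ} (hζ : IsPrimitiveRoot ζ N)
    (z : QWeyl (q : ℂ) (γ : ℂ)) :
    toWeyl N γ hq (weylTrace γ hN hq hζ z) = cyclicAverage N (QWeyl.scale (hζ.ne_zero hN)) z :=
  congrArg Subtype.val ((LinearEquiv.ofInjective (toWeyl N γ hq).toLinearMap
    (toWeyl_injective hq hN)).apply_symm_apply _)

/-- The dual bases of the quantum Weyl algebra over the quantum cone come from the coprimality of
`y^g x^g` and `x^(N-g) y^(N-g)`. -/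
theorem exists_dual_bases (hq : q ≠ 0) (hγ : γ ≠ 0) (hroots : q = -1 → N ≤ 2) {ζ : ℂ}
    (hζ0 : ζ ≠ 0) (hζ : ζ ^ N = 1) (g : Fin N) :
    ∃ u v : Bool → QWeyl (q : ℂ) (γ : ℂ),
      (∀ i, QWeyl.scale hζ0 (u i) = (ζ ^ (g : ℕ))⁻¹ • u i) ∧
      (∀ i, QWeyl.scale hζ0 (v i) = ζ ^ (g : ℕ) • v i) ∧ ∑ i, u i * v i = 1 := by
  obtain ⟨r, s, h⟩ := isCoprime_prod_coneFactor hq hγ hroots (Nat.add_sub_cancel' g.2.le)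
  have hg : ζ ^ (g : ℕ) * ζ ^ (N - g : ℕ) = 1 := by
    rw [← pow_add, Nat.add_sub_cancel' g.2.le, hζ]
  have hxn : ∀ n, QWeyl.scale hζ0 (QWeyl.x (q : ℂ) (γ : ℂ) ^ n) = ζ ^ n • QWeyl.x _ _ ^ n := by
    intro n; rw [map_pow, QWeyl.scale_x, _root_.smul_pow]
  have hyn : ∀ n, QWeyl.scale hζ0 (QWeyl.y (q : ℂ) (γ : ℂ) ^ n) =
      (ζ ^ n)⁻¹ • QWeyl.y _ _ ^ n := by
    intro n; rw [map_pow, QWeyl.scale_y, _root_.smul_pow, inv_pow]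
  have hf : ∀ f, QWeyl.scale hζ0 (aeval (QWeyl.xy q γ) f) = aeval (QWeyl.xy q γ) f :=
    QWeyl.scale_aeval hζ0
  -- The Bézout identity reads `r y ^ g · x ^ g + s x ^ (N - g) · y ^ (N - g) = 1`. Both left
  -- factors have weight `ζ ^ (-g)` because `ζ ^ N = 1`.
  refine ⟨fun i => if i then aeval (QWeyl.xy q γ) s * QWeyl.x _ _ ^ (N - g : ℕ) else
      aeval (QWeyl.xy q γ) r * QWeyl.y _ _ ^ (g : ℕ),
    fun i => if i then QWeyl.y _ _ ^ (N - g : ℕ) else QWeyl.x _ _ ^ (g : ℕ), ?_, ?_, ?_⟩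
  · rintro (_ | _)
    · simp only [Bool.false_eq_true, if_false]
      rw [map_mul, hf, hyn, mul_smul_comm]
    · simp only [if_true]
      rw [map_mul, hf, hxn, mul_smul_comm, eq_inv_of_mul_eq_one_right hg]
  · rintro (_ | _)
    · simp only [Bool.false_eq_true, if_false]
      rw [hxn]
    · simp only [if_true]
      rw [hyn, eq_inv_of_mul_eq_one_left hg]
  · rw [Fintype.sum_bool]
    simp only [Bool.false_eq_true, if_false, if_true]
    rw [mul_assoc, mul_assoc, QWeyl.x_pow_mul_y_pow hq, QWeyl.y_pow_mul_x_pow hq, ← map_mul,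
      ← map_mul, ← map_add, add_comm, h, map_one]

/-- The quantum Weyl algebra as an extension of the quantum cone. -/
theorem exists_cyclicTraceExtension (hN : N ≠ 0) (hq : q ≠ 0) (hγ : γ ≠ 0)
    (hroots : q = -1 → N ≤ 2) {ζ : ℂ} (hζ : IsPrimitiveRoot ζ N) :
    ∃ T : CyclicTraceExtension ℂ (QuantumCone N q γ) (QWeyl (q : ℂ) (γ : ℂ)),
      T.φ = toWeyl N γ hq ∧ T.θ = QWeyl.scale (hζ.ne_zero hN) ∧ T.N = N ∧
        ∀ b, T.φ (T.p b) = cyclicAverage N T.θ b := by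
  choose u v hu hv huv using exists_dual_bases hq hγ hroots (hζ.ne_zero hN) hζ.pow_eq_one
  have hN' : (N : ℂ) ≠ 0 := Nat.cast_ne_zero.2 hN
  have hspan := QWeyl.span_eigenvectors (γ := (γ : ℂ)) (Complex.ofReal_ne_zero.2 hq)
    (hζ.ne_zero hN) hζ.pow_eq_one
  have hθ : (QWeyl.scale (hζ.ne_zero hN) : QWeyl (q : ℂ) (γ : ℂ) →ₐ[ℂ] _) ^ N = 1 := by
    rw [QWeyl.scale_pow, QWeyl.scale_one _ hζ.pow_eq_one]
  refine ⟨{ φ := toWeyl N γ hq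
            p := weylTrace γ hN hq hζ
            p_mul_left := fun a b => ?_
            p_mul_right := fun a b => ?_
            ix := Fin N × Bool
            u := fun i => u i.1 i.2
            v := fun i => v i.1 i.2
            left_dual := fun b => ?_
            right_dual := fun b => ?_
            N := N
            N_ne_zero := hN'
            θ := QWeyl.scale (hζ.ne_zero hN)
            θ_pow := hθ
            θ_φ := scale_toWeyl hq _ hζ.pow_eq_one
            p_θ := fun b => ?_ }, rfl, rfl, rfl, toWeyl_weylTrace hN hq hζ⟩
  · apply toWeyl_injective hq hN
    rw [toWeyl_weylTrace, map_mul (toWeyl N γ hq), toWeyl_weylTrace,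
      cyclicAverage_fixed_mul _ (scale_toWeyl hq _ hζ.pow_eq_one a)]
  · apply toWeyl_injective hq hN
    rw [toWeyl_weylTrace, map_mul (toWeyl N γ hq), toWeyl_weylTrace,
      cyclicAverage_mul_of_fixed _ (scale_toWeyl hq _ hζ.pow_eq_one a)]
  · simp_rw [toWeyl_weylTrace]
    exact sum_cyclicAverage_mul hN' hζ hspan hu huv b
  · simp_rw [toWeyl_weylTrace]
    exact sum_mul_cyclicAverage hN' hζ hspan hv huv b
  · apply toWeyl_injective hq hN
    rw [toWeyl_weylTrace, toWeyl_weylTrace, cyclicAverage_map hθ]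

end QuantumCone

/-! ### The Koszul data of the quantum cone. -/

section BimoduleKoszul

open MulOpposite

/-- The identity of `A`, with values in the diagonal bimodule. -/
noncomputable def diagonalBimodule.equiv (k A : Type*) [Field k] [Ring A] [Algebra k A] :
    A ≃+ diagonalBimodule k A :=
  AddEquiv.refl A

theorem diagonalBimodule.smul_equiv {k A : Type*} [Field k] [Ring A] [Algebra k A] (a c m : A) :
    (a ⊗ₜ op c : EnvelopingAlgebra k A) • equiv k A m = equiv k A (a * m * c) := by
  let _ : Module (EnvelopingAlgebra k A) A := instModuleTensorProductMop k A
  refine (TensorProduct.Algebra.smul_def (M := A) a (op c) m).trans ?_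
  rw [op_smul_eq_mul, smul_eq_mul, mul_assoc]
  rfl

namespace QWeyl

variable {k : Type*} [Field k] {q γ : k}

section Scale

variable {c : k} (hc : c ≠ 0)

theorem envelopingMap_scale_kX : envelopingMap (scale hc) (kX q γ) = c • kX q γ := by
  rw [kX, map_sub, ← MulOpposite.op_one, envelopingMap_tmul, envelopingMap_tmul, map_one, scale_x,
    MulOpposite.op_smul, TensorProduct.tmul_smul, smul_sub]
  rfl

theorem envelopingMap_scale_kY : envelopingMap (scale hc) (kY q γ) = c⁻¹ • kY q γ := by
  rw [kY, map_sub, ← MulOpposite.op_one, envelopingMap_tmul, envelopingMap_tmul, map_one, scale_y,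
    MulOpposite.op_smul, TensorProduct.tmul_smul, smul_sub]
  rfl

theorem envelopingMap_scale_kX' : envelopingMap (scale hc) (kX' q γ) = c • kX' q γ := by
  rw [kX', map_sub, map_smul, ← MulOpposite.op_one, envelopingMap_tmul, envelopingMap_tmul, map_one,
    scale_x, MulOpposite.op_smul, TensorProduct.tmul_smul, smul_sub, smul_comm c q]
  rfl

theorem envelopingMap_scale_kY' : envelopingMap (scale hc) (kY' q γ) = c⁻¹ • kY' q γ := by
  rw [kY', map_sub, map_smul, ← MulOpposite.op_one, envelopingMap_tmul, envelopingMap_tmul, map_one,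
    scale_y, MulOpposite.op_smul, TensorProduct.tmul_smul, smul_sub, smul_comm c⁻¹ q]
  rfl

end Scale

theorem kε_envelopingMap {B : Type*} [Ring B] [Algebra k B] (θ : B →ₐ[k] B)
    (z : EnvelopingAlgebra k B) : kε (k := k) B (envelopingMap θ z) = θ (kε (k := k) B z) := by
  induction z using EnvelopingAlgebra.induction_on with
  | add x y hx hy => rw [map_add, map_add, hx, hy, map_add, map_add]
  | tmul b c => rw [envelopingMap_tmul, kε_tmul, kε_tmul, map_mul]

theorem kψ_envelopingMap {B : Type*} [Ring B] [Algebra k B] {ν θ : B →ₐ[k] B}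
    (h : ∀ b, ν (θ b) = θ (ν b)) (z : EnvelopingAlgebra k B) :
    kψ ν (envelopingMap θ z) = θ (kψ ν z) := by
  induction z using EnvelopingAlgebra.induction_on with
  | add x y hx hy => rw [map_add, map_add, hx, hy, map_add, map_add]
  | tmul b c => rw [envelopingMap_tmul, kψ_tmul, kψ_tmul, map_mul, h]

theorem scale_comm {c d : k} (hc : c ≠ 0) (hd : d ≠ 0) (b : QWeyl q γ) :
    scale hc (scale hd b) = scale hd (scale hc b) :=
  AlgHom.congr_fun (φ₁ := (scale hc).comp (scale hd)) (φ₂ := (scale hd).comp (scale hc))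
    (hom_ext (by simp [smul_comm c]) (by simp [smul_comm c⁻¹])) b

end QWeyl

namespace CyclicTraceExtension

variable {k A B : Type*} [Field k] [Ring A] [Ring B] [Algebra k A] [Algebra k B]
  {T : CyclicTraceExtension k A B}
  (hT : ∀ b, T.φ (T.p b) = cyclicAverage T.N T.θ b)

include hT in
theorem φ_p_of_fixed {b : B} (hb : T.θ b = b) : T.φ (T.p b) = b := by
  classical
  rw [hT, cyclicAverage_of_eigen T.N_ne_zero (one_pow _) (by rwa [one_smul]), if_pos rfl]

include hT in
theorem p_φ (hφ : Function.Injective T.φ) (a : A) : T.p (T.φ a) = a :=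
  hφ (φ_p_of_fixed hT (T.θ_φ a))

theorem tmul_mem_eigen {A B : Type*} [Ring A] [Ring B] [Algebra k A] [Algebra k B]
    (T : CyclicTraceExtension k A B) (a c : A) :
    envelopingMap T.θ (T.φ a ⊗ₜ op (T.φ c)) = (1 : k) • (T.φ a ⊗ₜ op (T.φ c)) := by
  rw [envelopingMap_tmul, T.θ_φ, T.θ_φ, one_smul]

end CyclicTraceExtension

namespace QuantumCone

variable {N : ℕ} {q γ : ℝ}

set_option maxHeartbeats 1000000 in
open QWeyl in
/-- The Koszul data of the quantum Weyl algebra, over the enveloping algebra of the quantum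
cone. -/
noncomputable def koszulData (hN : N ≠ 0) (hq : q ≠ 0) {ζ : ℂ} (hζ : IsPrimitiveRoot ζ N)
    (T : CyclicTraceExtension ℂ (QuantumCone N q γ) (QWeyl (q : ℂ) (γ : ℂ)))
    (hφ : T.φ = toWeyl N γ hq) (hθ : T.θ = QWeyl.scale (hζ.ne_zero hN)) (hTN : T.N = N)
    (hT : ∀ b, T.φ (T.p b) = cyclicAverage N T.θ b) :
    letI := T.envelopingModule
    T.enveloping.KoszulData (diagonalBimodule ℂ (QuantumCone N q γ)) (QuantumCone N q γ) :=
  letI := T.envelopingModule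
  have hq' : (q : ℂ) ≠ 0 := Complex.ofReal_ne_zero.2 hq
  have hinj : Function.Injective T.φ := hφ ▸ toWeyl_injective hq hN
  have hT' : ∀ b, T.φ (T.p b) = cyclicAverage T.N T.θ b := by rw [hTN]; exact hT
  -- Multiplication intertwines `Θ` with `θ`, so it sends invariants to invariants; the trace then
  -- merely regards the product as an element of the cone.
  have hε : ∀ z : T.enveloping.eigen (1 : ℂ), T.φ (T.p (kε (k := ℂ) _ (z : EnvelopingAlgebra ℂ _)))
      = kε (k := ℂ) _ (z : EnvelopingAlgebra ℂ _) := fun z =>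
    CyclicTraceExtension.φ_p_of_fixed hT' (by
      rw [← kε_envelopingMap]
      exact congrArg _ (z.2.trans (one_smul _ _)))
  have hψ : ∀ z : T.enveloping.eigen (1 : ℂ),
      T.φ (T.p (kψ (QWeyl.scale (inv_ne_zero hq')) (z : EnvelopingAlgebra ℂ _)))
      = kψ (QWeyl.scale (inv_ne_zero hq')) (z : EnvelopingAlgebra ℂ _) := fun z =>
    CyclicTraceExtension.φ_p_of_fixed hT' (by
      -- The twisted multiplication has the same property because the twist commutes with `θ`.
      rw [← kψ_envelopingMap (by rw [hθ]; exact QWeyl.scale_comm _ _)]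
      exact congrArg _ (z.2.trans (one_smul _ _)))
  { ζ := ζ
    ζ_pow := by
      change ζ ^ T.N = 1
      rw [hTN, hζ.pow_eq_one]
    X := kX _ _
    Y := kY _ _
    X' := kX' _ _
    Y' := kY' _ _
    X_mem := by
      change envelopingMap T.θ _ = _
      rw [hθ, envelopingMap_scale_kX]
    Y_mem := by
      change envelopingMap T.θ _ = _
      rw [hθ, envelopingMap_scale_kY]
    X'_mem := by
      change envelopingMap T.θ _ = _
      rw [hθ, envelopingMap_scale_kX']
    Y'_mem := by
      change envelopingMap T.θ _ = _
      rw [hθ, envelopingMap_scale_kY']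
    rel := kY'_mul_kX_add _ _
    exact_left := koszul_exact_left hq'
    injective_left := koszul_injective_left hq'
    exact_right := koszul_exact_right hq'
    injective_right := koszul_injective_right hq'
    ε :=
      { toFun := fun z => diagonalBimodule.equiv ℂ _
          (T.p (kε (k := ℂ) _ (z : EnvelopingAlgebra ℂ _)))
        map_add' := fun x y => by rw [Submodule.coe_add, map_add, map_add, map_add]
        map_smul' := fun s z => by
          rw [RingHom.id_apply]
          induction s using EnvelopingAlgebra.induction_on with
          | add s t hs ht =>
            rw [add_smul, add_smul, ← hs, ← ht, Submodule.coe_add, map_add, map_add, map_add]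
          | tmul a c =>
            rw [diagonalBimodule.smul_equiv]
            change diagonalBimodule.equiv ℂ _ (T.p (kε (k := ℂ) _
              (envelopingMap T.φ (a ⊗ₜ op c) * (z : EnvelopingAlgebra ℂ _)))) = _
            rw [envelopingMap_tmul, kε_mul, T.p_mul_right, T.p_mul_left] }
    ε_surjective := fun m => by
      obtain ⟨a, rfl⟩ := (diagonalBimodule.equiv ℂ _).surjective m
      refine ⟨⟨T.φ 1 ⊗ₜ op (T.φ a), T.tmul_mem_eigen 1 a⟩, ?_⟩
      change diagonalBimodule.equiv ℂ _ (T.p (kε (k := ℂ) _ (T.φ 1 ⊗ₜ op (T.φ a)))) = _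
      rw [kε_tmul, map_one, one_mul, CyclicTraceExtension.p_φ hT' hinj]
    ε_eq_zero := fun z => by
      refine ((diagonalBimodule.equiv ℂ (QuantumCone N q γ)).map_eq_zero_iff).trans ?_
      rw [← kε_eq_zero_iff, ← map_eq_zero_iff T.φ hinj, hε]
    ψ := (T.p ∘ₗ kψ (QWeyl.scale (inv_ne_zero hq'))).toAddMonoidHom.comp
      (T.enveloping.eigen (1 : ℂ)).subtype.toAddMonoidHom
    ψ_surjective := fun a => by
      refine ⟨⟨T.φ 1 ⊗ₜ op (T.φ a), T.tmul_mem_eigen 1 a⟩, ?_⟩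
      change T.p (kψ _ (T.φ 1 ⊗ₜ op (T.φ a))) = a
      rw [kψ_tmul, map_one, map_one, mul_one, CyclicTraceExtension.p_φ hT' hinj]
    ψ_eq_zero := fun z => by
      rw [← kψ_eq_zero_iff hq', ← hψ]
      exact (map_eq_zero_iff T.φ hinj).symm }

end QuantumCone

end BimoduleKoszul

theorem theorem2 (N : ℕ) (hN : 1 ≤ N) (q γ : ℝ) (hq : q ≠ 0) (hγ : γ ≠ 0)
    (hroots : q = -1 → N ≤ 2) :
    IsTwistedCalabiYau ℂ (QuantumCone N q γ) 2 := by
  have hN0 : N ≠ 0 := by omega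
  have hq' : (q : ℂ) ≠ 0 := Complex.ofReal_ne_zero.2 hq
  obtain ⟨ζ, hζ⟩ : ∃ ζ : ℂ, IsPrimitiveRoot ζ N := ⟨_, Complex.isPrimitiveRoot_exp N hN0⟩
  obtain ⟨T, hφ, hθ, hTN, hT⟩ := QuantumCone.exists_cyclicTraceExtension hN0 hq hγ hroots hζ
  let _ := T.envelopingModule
  let K := QuantumCone.koszulData hN0 hq hζ T hφ hθ hTN hT
  refine ⟨K.exists_projectiveResolution, K.subsingleton_ext, ?_⟩
  obtain ⟨e, he⟩ := K.exists_ext_two_equiv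
  -- The twist `x ↦ q⁻¹ x`, `y ↦ q y` restricts to the cone as rescaling of `b` by `q ^ (-N)`. The
  -- inner action is right multiplication by `v ⊗ op u`, which `kψ` turns into `m ↦ u m ν(v)`.
  refine ⟨QuantumCone.scaleEquiv (pow_ne_zero N (inv_ne_zero hq')), e, fun u v ξ => ?_⟩
  refine he (v ⊗ₜ MulOpposite.op u) (fun m => u * m * QuantumCone.scaleEquiv _ v) (fun z => ?_) ξ
  change T.p (QWeyl.kψ (QWeyl.scale (inv_ne_zero hq'))
    ((z : EnvelopingAlgebra ℂ _) * envelopingMap T.φ (v ⊗ₜ MulOpposite.op u))) =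
      u * T.p (QWeyl.kψ (QWeyl.scale (inv_ne_zero hq')) (z : EnvelopingAlgebra ℂ _)) *
        QuantumCone.scale (pow_ne_zero N (inv_ne_zero hq')) v
  rw [envelopingMap_tmul, QWeyl.kψ_mul, hφ, ← QuantumCone.toWeyl_scale, ← hφ, T.p_mul_right,
    T.p_mul_left]
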